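/- Let $K$ be a field of characteristic different from $2$ and $3$, with algebraic closure $\overline K$. For $n=2,3,4$ let $X_n$ be the affine space over $K$ of genus one models of degree $n$: - $n=2$: pairs $\phi=(p,q)$, $p=\alpha_0x^2+\alpha_1xz+\alpha_2z^2$, $q=ax^4+bx^3z+cx^2z^2+dxz^3+ez^4$, with curve $y^2+p(x,z)y=q(x,z)$; - $n=3$: ternary cubics $\phi=ax^3+by^3+cz^3+a_2x^2y+a_3x^2z+b_1xy^2+b_3y^2z+c_1xz^2+c_2yz^2+mxyz$; - $n=4$: pairs $\phi=(q_1,q_2)$ of quadrics in $x_0,x_1,x_2,x_3$. *The discriminant.* Let $\mathcal G_n$ be the following group acting on $X_n$. For $n=2$ its elements are $[\mu,r,B]$ with $\mu\neq 0$, $r$ a binary quadratic form, $B\in GL_2$, sending $(p,q)$ to $(\mu\,p\circ B+2r,\ \mu^2q\circ B-\mu r\,(p\circ B)-r^2)$, and $\det[\mu,r,B]=\mu\det B$. For $n=3$ they are $[\mu,B]$ with $\mu\ne0$, $B\in GL_3$, sending $\phi$ to $\mu\,\phi\circ B$, and $\det[\mu,B]=\mu\det B$. For $n=4$ they are $[A,B]$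 with $A\in GL_2$, $B\in GL_4$, sending $(q_1,q_2)$ to $\big(\sum_l A_{kl}\,q_l\circ B\big)_{k=1,2}$, and $\det[A,B]=\det A\det B$. A polynomial $I\in K[X_n]$ is an invariant of weight $k$ if $I(g\phi)=(\det g)^kI(\phi)$ for all $g\in\mathcal G_n(\overline K)$ and $\phi\in X_n(\overline K)$. The Weierstrass curve $y^2+a_1xy+a_3y=x^3+a_2x^2+a_4x+a_6$ is regarded as the model - $n=2$: $y^2+(a_1xz+a_3z^2)y=x^3z+a_2x^2z^2+a_4xz^3+a_6z^4$; - $n=3$: $y^2z+a_1xyz+a_3yz^2-x^3-a_2x^2z-a_4xz^2-a_6z^3$; - $n=4$: $\big(x_0x_3-x_1^2,\ x_2^2+a_1x_1x_2+a_3x_0x_2-x_1x_3-a_2x_1^2-a_4x_0x_1-a_6x_0^2\big)$. Let $c_4,c_6\in K[X_n]$ be the invariants of weights $4$ and $6$ that restrict to the usual $c_4,c_6$ on Weierstrass curves over $\overline K$. The normalized discriminant of $X_n$ is $\Delta=(c_4^3-c_6^2)/1728\in K[X_n]$, and $\Delta_\phi$ denotes its value at $\phi\in X_n(K)$. *The Weierstrass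 form of the Jacobian.* For $\phi\in X_n(K)$ the form $\varphi_n(\phi)$ is defined as follows. - $n=2$: complete the square to $y^2=q+p^2/4=ax^4+bx^3z+cx^2z^2+dxz^3+ez^4$ (with new $a,\dots,e$). Then $\varphi_2(\phi)$ is $y^2=4x^3-ix-j$, where $i=(12ae-3bd+c^2)/12$ and $j=(72ace-27ad^2-27b^2e+9bcd-2c^3)/432$. - $n=3$: $\varphi_3(\phi)$ is $y^2=4x^3+108Sx-27T$, where $S,T$ are the classical Aronhold invariants of the cubic, that is, the $SL_3(\overline K)$-invariant polynomials of degrees $4$ and $6$ in the coefficients that take the values $S=abcm-m^4$ and $T=a^2b^2c^2-20abcm^3-8m^6$ on $ax^3+by^3+cz^3+6mxyz$. - $n=4$: write $q_1=\overline xA\overline x^T$, $q_2=\overline xB\overline x^T$ with $A,B$ symmetric. Then $\varphi_4(\phi)$ is $y^2=4x^3-ix-j$ with $i,j$ computed as above from the coefficients of the quartic $\det(xA+zB)=ax^4+bx^3z+cx^2z^2+dxz^3+ez^4$. The discriminant of a form $y^2=4x^3-g_2x-g_3$ is $(c_4^3-c_6^2)/1728$ with $c_4=2^6\cdot3\,g_2$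 and $c_6=2^9\cdot3^3g_3$; that is, it is $2^{12}(g_2^3-27g_3^2)$. **Theorem.** For $n=2,3,4$ the normalized discriminant of $X_n$ exists and is unique, and for every model $\phi\in X_n(K)$, smooth or not, $$\Delta_\phi=\alpha_n^{12}\,\Delta_{\varphi_n(\phi)},\qquad \alpha_2=1,\quad \alpha_3=\tfrac12,\quad \alpha_4=2,$$ so that the constants are $1$, $2^{-12}$ and $2^{12}$. -/

import Mathlib

noncomputable section

namespace GenusOne

open MvPolynomial

/-! ### Models of degree 2, 3, 4 as points of affine space

A model of degree `n` with coefficients in `R` is a function from the coordinates of the affine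
space `X_n` to `R`; the coordinate ring of `X_n` over `K` is `MvPolynomial` in these coordinates. -/

/-- Coordinates of `X_2`, for
`y² + (α₀x² + α₁xz + α₂z²) y = a x⁴ + b x³z + c x²z² + d xz³ + e z⁴`. -/
inductive Coord2
  | α₀ | α₁ | α₂ | a | b | c | d | e
  deriving DecidableEq

/-- Coordinates of `X_3`, for the ternary cubic
`a x³ + b y³ + c z³ + a₂ x²y + a₃ x²z + b₁ xy² + b₃ y²z + c₁ xz² + c₂ yz² + m xyz`. -/
inductive Coord3
  | a | b | c | a₂ | a₃ | b₁ | b₃ | c₁ | c₂ | m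
  deriving DecidableEq

/-- Coefficients of a quadric in four variables: `cij` is the coefficient of `x_i x_j`. -/
inductive QuadricCoord
  | c00 | c01 | c02 | c03 | c11 | c12 | c13 | c22 | c23 | c33
  deriving DecidableEq

/-- Coordinates of `X_4` (pairs of quadrics in four variables). -/
abbrev Coord4 : Type := Fin 2 × QuadricCoord

section Forms

variable {R : Type*} [CommRing R]

/-- The binary quadratic `p(x, z)` of a model of degree 2, with `x = X 0` and `z = X 1`. -/
def quadraticForm (φ : Coord2 → R) : MvPolynomial (Fin 2) R :=
  C (φ .α₀) * X 0 ^ 2 + C (φ .α₁) * X 0 * X 1 + C (φ .α₂) * X 1 ^ 2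

/-- The binary quartic `q(x, z)` of a model of degree 2, with `x = X 0` and `z = X 1`. -/
def quarticForm (φ : Coord2 → R) : MvPolynomial (Fin 2) R :=
  C (φ .a) * X 0 ^ 4 + C (φ .b) * X 0 ^ 3 * X 1 + C (φ .c) * X 0 ^ 2 * X 1 ^ 2
    + C (φ .d) * X 0 * X 1 ^ 3 + C (φ .e) * X 1 ^ 4

/-- The ternary cubic of a model of degree 3, with `x = X 0`, `y = X 1`, `z = X 2`. -/
def cubicForm (φ : Coord3 → R) : MvPolynomial (Fin 3) R :=
  C (φ .a) * X 0 ^ 3 + C (φ .b) * X 1 ^ 3 + C (φ .c) * X 2 ^ 3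
    + C (φ .a₂) * X 0 ^ 2 * X 1 + C (φ .a₃) * X 0 ^ 2 * X 2
    + C (φ .b₁) * X 0 * X 1 ^ 2 + C (φ .b₃) * X 1 ^ 2 * X 2
    + C (φ .c₁) * X 0 * X 2 ^ 2 + C (φ .c₂) * X 1 * X 2 ^ 2
    + C (φ .m) * X 0 * X 1 * X 2

/-- The quadric in `x_0, …, x_3` with given coefficients. -/
def quadricForm (q : QuadricCoord → R) : MvPolynomial (Fin 4) R :=
  C (q .c00) * X 0 ^ 2 + C (q .c01) * X 0 * X 1 + C (q .c02) * X 0 * X 2 + C (q .c03) * X 0 * X 3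
    + C (q .c11) * X 1 ^ 2 + C (q .c12) * X 1 * X 2 + C (q .c13) * X 1 * X 3
    + C (q .c22) * X 2 ^ 2 + C (q .c23) * X 2 * X 3 + C (q .c33) * X 3 ^ 2

/-- The linear substitution `x_i ↦ ∑ j, B i j * x_j`. -/
def linSubst {ι : Type*} [Fintype ι] (B : Matrix ι ι R) :
    MvPolynomial ι R →ₐ[R] MvPolynomial ι R :=
  aeval fun i => ∑ j, C (B i j) * X j

/-! ### The groups acting on models

Each relation says that `φ'` is the transform of `φ` under the given group element. -/

/-- `φ' = [μ, r, B] φ` in degree 2: in `y² + p y = q` substitute `B` into `(x, z)`, replace `y` by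
`μ⁻¹ (y + r₀x² + r₁xz + r₂z²)`, and multiply the equation by `μ²`. -/
def Transforms2 (μ : R) (r : Fin 3 → R) (B : Matrix (Fin 2) (Fin 2) R) (φ φ' : Coord2 → R) :
    Prop :=
  let ρ : MvPolynomial (Fin 2) R :=
    C (r 0) * X 0 ^ 2 + C (r 1) * X 0 * X 1 + C (r 2) * X 1 ^ 2
  quadraticForm φ' = C μ * linSubst B (quadraticForm φ) + 2 * ρ ∧
  quarticForm φ' =
    C μ ^ 2 * linSubst B (quarticForm φ) - C μ * ρ * linSubst B (quadraticForm φ) - ρ ^ 2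

/-- `φ' = [μ, B] φ` in degree 3: `φ' = μ · (φ ∘ B)`. -/
def Transforms3 (μ : R) (B : Matrix (Fin 3) (Fin 3) R) (φ φ' : Coord3 → R) : Prop :=
  cubicForm φ' = C μ * linSubst B (cubicForm φ)

/-- `φ' = [A, B] φ` in degree 4: `q'_k = ∑ l, A k l · (q_l ∘ B)`. -/
def Transforms4 (A : Matrix (Fin 2) (Fin 2) R) (B : Matrix (Fin 4) (Fin 4) R)
    (φ φ' : Coord4 → R) : Prop :=
  ∀ k, quadricForm (fun s => φ' (k, s)) =
    ∑ l, C (A k l) * linSubst B (quadricForm fun s => φ (l, s))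

/-! ### The Weierstrass family inside `X_2`, `X_3`, `X_4` -/

/-- `y² + (a₁xz + a₃z²) y = x³z + a₂x²z² + a₄xz³ + a₆z⁴`. -/
def weierstrass2 (W : WeierstrassCurve R) : Coord2 → R
  | .α₀ => 0
  | .α₁ => W.a₁
  | .α₂ => W.a₃
  | .a => 0
  | .b => 1
  | .c => W.a₂
  | .d => W.a₄
  | .e => W.a₆

/-- `y²z + a₁xyz + a₃yz² - x³ - a₂x²z - a₄xz² - a₆z³`. -/
def weierstrass3 (W : WeierstrassCurve R) : Coord3 → R
  | .a => -1
  | .b => 0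
  | .c => -W.a₆
  | .a₂ => 0
  | .a₃ => -W.a₂
  | .b₁ => 0
  | .b₃ => 1
  | .c₁ => -W.a₄
  | .c₂ => W.a₃
  | .m => W.a₁

/-- The image of the Weierstrass curve under `(x_0 : x_1 : x_2 : x_3) = (1 : x : y : x²)`, i.e.
`x_0x_3 - x_1² = 0` and
`x_2² + a₁x_1x_2 + a₃x_0x_2 - x_1x_3 - a₂x_1² - a₄x_0x_1 - a₆x_0² = 0`. -/
def weierstrass4 (W : WeierstrassCurve R) : Coord4 → R
  | (0, .c03) => 1
  | (0, .c11) => -1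
  | (0, _) => 0
  | (1, .c00) => -W.a₆
  | (1, .c01) => -W.a₄
  | (1, .c02) => W.a₃
  | (1, .c03) => 0
  | (1, .c11) => -W.a₂
  | (1, .c12) => W.a₁
  | (1, .c13) => -1
  | (1, .c22) => 1
  | (1, .c23) => 0
  | (1, .c33) => 0

end Forms

/-! ### Invariants and the normalized discriminant -/

section Invariants

variable {K : Type*} [Field K]

/-- `I ∈ K[X_2]` is an invariant of weight `k`: `I(gφ) = (det g)^k I(φ)` for all `g` with
coefficients in the algebraic closure, where `det [μ, r, B] = μ det B`. -/
def IsInvariant2 (k : ℕ) (I : MvPolynomial Coord2 K) : Prop :=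
  ∀ (μ : (AlgebraicClosure K)ˣ) (r : Fin 3 → AlgebraicClosure K)
    (B : GL (Fin 2) (AlgebraicClosure K)) (φ φ' : Coord2 → AlgebraicClosure K),
    Transforms2 (μ : AlgebraicClosure K) r B.val φ φ' →
      aeval φ' I = (μ * B.val.det) ^ k * aeval φ I

/-- `I ∈ K[X_3]` is an invariant of weight `k`, where `det [μ, B] = μ det B`. -/
def IsInvariant3 (k : ℕ) (I : MvPolynomial Coord3 K) : Prop :=
  ∀ (μ : (AlgebraicClosure K)ˣ) (B : GL (Fin 3) (AlgebraicClosure K))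
    (φ φ' : Coord3 → AlgebraicClosure K),
    Transforms3 (μ : AlgebraicClosure K) B.val φ φ' →
      aeval φ' I = (μ * B.val.det) ^ k * aeval φ I

/-- `I ∈ K[X_4]` is an invariant of weight `k`, where `det [A, B] = det A det B`. -/
def IsInvariant4 (k : ℕ) (I : MvPolynomial Coord4 K) : Prop :=
  ∀ (A : GL (Fin 2) (AlgebraicClosure K)) (B : GL (Fin 4) (AlgebraicClosure K))
    (φ φ' : Coord4 → AlgebraicClosure K),
    Transforms4 A.val B.val φ φ' →
      aeval φ' I = (A.val.det * B.val.det) ^ k * aeval φ I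

/-- `D = (c₄³ - c₆²) / 1728`, where `c₄`, `c₆` are the invariants of weights 4 and 6 that restrict
to the usual `c₄`, `c₆` on the Weierstrass family. (Used only when `6 ≠ 0` in `K`.) -/
def IsDiscriminantFor {σ : Type*} (inv : ℕ → MvPolynomial σ K → Prop)
    (family : WeierstrassCurve (AlgebraicClosure K) → σ → AlgebraicClosure K)
    (D : MvPolynomial σ K) : Prop :=
  ∃ c₄ c₆ : MvPolynomial σ K,
    (inv 4 c₄ ∧ ∀ W, aeval (family W) c₄ = W.c₄) ∧
    (inv 6 c₆ ∧ ∀ W, aeval (family W) c₆ = W.c₆) ∧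
    1728 * D = c₄ ^ 3 - c₆ ^ 2

/-- `D` is the normalized discriminant of genus one models of degree 2. -/
def IsDiscriminant2 (D : MvPolynomial Coord2 K) : Prop :=
  IsDiscriminantFor IsInvariant2 weierstrass2 D

/-- `D` is the normalized discriminant of genus one models of degree 3. -/
def IsDiscriminant3 (D : MvPolynomial Coord3 K) : Prop :=
  IsDiscriminantFor IsInvariant3 weierstrass3 D

/-- `D` is the normalized discriminant of genus one models of degree 4. -/
def IsDiscriminant4 (D : MvPolynomial Coord4 K) : Prop :=
  IsDiscriminantFor IsInvariant4 weierstrass4 D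

end Invariants

/-! ### Classical Weierstrass forms -/

/-- The Weierstrass form `y² = 4x³ - g₂x - g₃`. -/
@[ext]
structure ClassicalForm (K : Type*) where
  g₂ : K
  g₃ : K

namespace ClassicalForm

variable {K : Type*} [Field K]

/-- The integral model `Y² = X³ - 4g₂X - 16g₃`, obtained by `X = 4x`, `Y = 4y`; this change of
variables takes `dX/(2Y)` to `dx/(2y)`. -/
def toWeierstrassCurve (W : ClassicalForm K) : WeierstrassCurve K :=
  ⟨0, 0, 0, -4 * W.g₂, -16 * W.g₃⟩

/-- The normalized invariant `c₄ = 2⁶·3·g₂`. -/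
def c₄ (W : ClassicalForm K) : K := 2 ^ 6 * 3 * W.g₂

/-- The normalized invariant `c₆ = 2⁹·3³·g₃`. -/
def c₆ (W : ClassicalForm K) : K := 2 ^ 9 * 3 ^ 3 * W.g₃

/-- The discriminant `(c₄³ - c₆²) / 1728`. (Used only when `6 ≠ 0` in `K`.) -/
def Δ (W : ClassicalForm K) : K := (W.c₄ ^ 3 - W.c₆ ^ 2) / 1728

theorem c₄_toWeierstrassCurve (W : ClassicalForm K) : W.toWeierstrassCurve.c₄ = W.c₄ := by
  simp only [toWeierstrassCurve, c₄, WeierstrassCurve.c₄, WeierstrassCurve.b₂, WeierstrassCurve.b₄]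
  ring

theorem c₆_toWeierstrassCurve (W : ClassicalForm K) : W.toWeierstrassCurve.c₆ = W.c₆ := by
  simp only [toWeierstrassCurve, c₆, WeierstrassCurve.c₆, WeierstrassCurve.b₂, WeierstrassCurve.b₄,
    WeierstrassCurve.b₆]
  ring

end ClassicalForm

/-! ### The maps `φ_n` from models to Weierstrass forms, in characteristic different from 2 and 3 -/

section Jacobian

variable {K : Type*} [Field K]

/-- The classical invariant `i` of `a x⁴ + b x³z + c x²z² + d xz³ + e z⁴`. -/
def quarticI (a b c d e : K) : K := (12 * a * e - 3 * b * d + c ^ 2) / 12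

/-- The classical invariant `j` of `a x⁴ + b x³z + c x²z² + d xz³ + e z⁴`. -/
def quarticJ (a b c d e : K) : K :=
  (72 * a * c * e - 27 * a * d ^ 2 - 27 * b ^ 2 * e + 9 * b * c * d - 2 * c ^ 3) / 432

/-- `φ_2`: complete the square to `y² = q + p²/4` and take `y² = 4x³ - i x - j`. -/
def jacobian2 (φ : Coord2 → K) : ClassicalForm K :=
  let a := φ .a + φ .α₀ ^ 2 / 4
  let b := φ .b + φ .α₀ * φ .α₁ / 2
  let c := φ .c + (φ .α₁ ^ 2 + 2 * φ .α₀ * φ .α₂) / 4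
  let d := φ .d + φ .α₁ * φ .α₂ / 2
  let e := φ .e + φ .α₂ ^ 2 / 4
  ⟨quarticI a b c d e, quarticJ a b c d e⟩

/-- The classical (Aronhold) invariant `S` of the cubic
`a x³ + b y³ + c z³ + 3a₂ x²y + 3a₃ x²z + 3b₁ xy² + 3b₃ y²z + 3c₁ xz² + 3c₂ yz² + 6m xyz`. -/
def aronholdS (a b c a₂ a₃ b₁ b₃ c₁ c₂ m : K) : K :=
  a*b*c*m - (b*c*a₂*a₃ + c*a*b₁*b₃ + a*b*c₁*c₂)
  - m*(a*b₃*c₂ + b*c₁*a₃ + c*a₂*b₁)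
  + (a*b₁*c₂^2 + a*c₁*b₃^2 + b*a₂*c₁^2 + b*c₂*a₃^2 + c*b₃*a₂^2 + c*a₃*b₁^2)
  - m^4 + 2*m^2*(b₁*c₁ + c₂*a₂ + a₃*b₃)
  - 3*m*(a₂*b₃*c₁ + a₃*b₁*c₂)
  - (b₁^2*c₁^2 + c₂^2*a₂^2 + a₃^2*b₃^2)
  + (c₂*a₂*a₃*b₃ + a₃*b₃*b₁*c₁ + b₁*c₁*c₂*a₂)

/-- The classical (Aronhold) invariant `T` of the cubic
`a x³ + b y³ + c z³ + 3a₂ x²y + 3a₃ x²z + 3b₁ xy² + 3b₃ y²z + 3c₁ xz² + 3c₂ yz² + 6m xyz`. -/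
def aronholdT (a b c a₂ a₃ b₁ b₃ c₁ c₂ m : K) : K :=
  a^2*b^2*c^2 - 6*a*b*c*(a*b₃*c₂ + b*c₁*a₃ + c*a₂*b₁) - 20*a*b*c*m^3
  + 12*a*b*c*m*(b₁*c₁ + c₂*a₂ + a₃*b₃) + 6*a*b*c*(a₂*b₃*c₁ + a₃*b₁*c₂)
  + 4*(a^2*b*c₂^3 + a^2*c*b₃^3 + b^2*c*a₃^3 + b^2*a*c₁^3 + c^2*a*b₁^3 + c^2*b*a₂^3)
  + 36*m^2*(b*c*a₂*a₃ + c*a*b₁*b₃ + a*b*c₁*c₂)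
  - 24*m*(b*c*b₁*a₃^2 + b*c*c₁*a₂^2 + c*a*c₂*b₁^2 + c*a*a₂*b₃^2 + a*b*a₃*c₂^2 + a*b*b₃*c₁^2)
  - 3*(a^2*b₃^2*c₂^2 + b^2*c₁^2*a₃^2 + c^2*a₂^2*b₁^2)
  + 18*(b*c*b₁*c₁*a₂*a₃ + c*a*c₂*a₂*b₃*b₁ + a*b*a₃*b₃*c₁*c₂)
  - 12*(b*c*c₂*a₃*a₂^2 + b*c*b₃*a₂*a₃^2 + c*a*c₁*b₃*b₁^2 + c*a*a₃*b₁*b₃^2 + a*b*a₂*c₁*c₂^2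
      + a*b*b₁*c₂*c₁^2)
  - 12*m^3*(a*b₃*c₂ + b*c₁*a₃ + c*a₂*b₁)
  + 12*m^2*(a*b₁*c₂^2 + a*c₁*b₃^2 + b*a₂*c₁^2 + b*c₂*a₃^2 + c*b₃*a₂^2 + c*a₃*b₁^2)
  - 60*m*(a*b₁*b₃*c₁*c₂ + b*c₁*c₂*a₂*a₃ + c*a₂*a₃*b₁*b₃)
  + 12*m*(a*a₂*b₃*c₂^2 + a*a₃*c₂*b₃^2 + b*b₃*c₁*a₃^2 + b*b₁*a₃*c₁^2 + c*c₁*a₂*b₁^2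
      + c*c₂*b₁*a₂^2)
  + 6*(a*b₃*c₂ + b*c₁*a₃ + c*a₂*b₁)*(a₂*b₃*c₁ + a₃*b₁*c₂)
  + 24*(a*b₁*b₃^2*c₁^2 + a*c₁*c₂^2*b₁^2 + b*c₂*c₁^2*a₂^2 + b*a₂*a₃^2*c₂^2 + c*a₃*a₂^2*b₃^2
      + c*b₃*b₁^2*a₃^2)
  - 12*(a*a₂*b₁*c₂^3 + a*a₃*c₁*b₃^3 + b*b₃*c₂*a₃^3 + b*b₁*a₂*c₁^3 + c*c₁*a₃*b₁^3 + c*c₂*b₃*a₂^3)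
  - 8*m^6 + 24*m^4*(b₁*c₁ + c₂*a₂ + a₃*b₃) - 36*m^3*(a₂*b₃*c₁ + a₃*b₁*c₂)
  - 12*m^2*(b₁*c₁*c₂*a₂ + c₂*a₂*a₃*b₃ + a₃*b₃*b₁*c₁)
  - 24*m^2*(b₁^2*c₁^2 + c₂^2*a₂^2 + a₃^2*b₃^2)
  + 36*m*(a₂*b₃*c₁ + a₃*b₁*c₂)*(b₁*c₁ + c₂*a₂ + a₃*b₃)
  + 8*(b₁^3*c₁^3 + c₂^3*a₂^3 + a₃^3*b₃^3)
  - 27*(a₂^2*b₃^2*c₁^2 + a₃^2*b₁^2*c₂^2)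
  - 6*b₁*c₁*c₂*a₂*a₃*b₃
  - 12*(b₁^2*c₁^2*c₂*a₂ + b₁^2*c₁^2*a₃*b₃ + c₂^2*a₂^2*a₃*b₃ + c₂^2*a₂^2*b₁*c₁
      + a₃^2*b₃^2*b₁*c₁ + a₃^2*b₃^2*c₂*a₂)

/-- `S` of a model of degree 3. -/
def cubicS (φ : Coord3 → K) : K :=
  aronholdS (φ .a) (φ .b) (φ .c) (φ .a₂ / 3) (φ .a₃ / 3) (φ .b₁ / 3) (φ .b₃ / 3) (φ .c₁ / 3)
    (φ .c₂ / 3) (φ .m / 6)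

/-- `T` of a model of degree 3. -/
def cubicT (φ : Coord3 → K) : K :=
  aronholdT (φ .a) (φ .b) (φ .c) (φ .a₂ / 3) (φ .a₃ / 3) (φ .b₁ / 3) (φ .b₃ / 3) (φ .c₁ / 3)
    (φ .c₂ / 3) (φ .m / 6)

/-- `φ_3`: the Weierstrass form `y² = 4x³ + 108 S x - 27 T`. -/
def jacobian3 (φ : Coord3 → K) : ClassicalForm K :=
  ⟨-108 * cubicS φ, 27 * cubicT φ⟩

/-- The symmetric matrix `A` with `q = x A xᵀ`. -/
def symMatrix (q : QuadricCoord → K) : Matrix (Fin 4) (Fin 4) K :=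
  !![q .c00, q .c01 / 2, q .c02 / 2, q .c03 / 2;
     q .c01 / 2, q .c11, q .c12 / 2, q .c13 / 2;
     q .c02 / 2, q .c12 / 2, q .c22, q .c23 / 2;
     q .c03 / 2, q .c13 / 2, q .c23 / 2, q .c33]

/-- The dehomogenized quartic `det (t A + B)` of a pair of quadrics; the coefficient of `t^k` is
the coefficient of `x^k z^(4-k)` in `det (x A + z B)`. -/
def pencilQuartic (φ : Coord4 → K) : Polynomial K :=
  Matrix.det ((Polynomial.X : Polynomial K) • (symMatrix fun s => φ (0, s)).map (Polynomial.C : K →+* Polynomial K)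
    + (symMatrix fun s => φ (1, s)).map (Polynomial.C : K →+* Polynomial K))

/-- `φ_4`: the Weierstrass form `y² = 4x³ - i x - j` for the quartic `det (x A + z B)`. -/
def jacobian4 (φ : Coord4 → K) : ClassicalForm K :=
  let g := pencilQuartic φ
  ⟨quarticI (g.coeff 4) (g.coeff 3) (g.coeff 2) (g.coeff 1) (g.coeff 0),
   quarticJ (g.coeff 4) (g.coeff 3) (g.coeff 2) (g.coeff 1) (g.coeff 0)⟩

end Jacobian

end GenusOne

end

/-!
The invariants `c₄` and `c₆` are written down explicitly. In degrees 2 and 4 they are `I` and `J / 2`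
for the classical invariants `I`, `J` of a binary quartic attached to the model: `4q + p²` in degree
2, and `det (2xA + 2zB)` in degree 4. A transformation of the model acts on this quartic by a linear
substitution and a scalar (`Transforms2.completedQuartic_eq`, `resolventQuartic_model4Subst`), so
invariance follows from the identities for `I` and `J`. In degree 3 they are `-6⁴ S` and `6⁶ T / 8`
for the Aronhold invariants, whose invariance is checked on transvections and diagonal matrices
(`scaled_cubicSubst`). Comparison with the definition of `φ_n` then gives the factors `α_n`.

Uniqueness says that an invariant vanishing on all Weierstrass curves is zero, that is, that the
orbits of Weierstrass curves are dense. This needs neither flexes nor rational points on the curve: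
it suffices that at one model, here the cuspidal curve `y² = x³`, the tangent directions of the
family (group element, `a₄`, `a₆`) span the whole space, which is a linear computation valid
outside characteristics 2 and 3 (`eq_zero_of_cuspOrbit2`, `eq_zero_of_cuspOrbit3`,
`eq_zero_of_cuspOrbit4`). That a spanning tangent space forces density, in any characteristic, is
`eq_zero_of_curves`: along a curve through the point, the lowest-degree part of a nonzero polynomial
would vanish in every direction. -/

noncomputable section

namespace GenusOne

open MvPolynomial

/-! ### Polynomials that vanish on enough curves -/

section Density

variable {σ K L : Type*} [Field K] [Field L] [Algebra K L]

theorem aeval_X_mul_of_isHomogeneous {F : MvPolynomial σ L} {n : ℕ} (hF : F.IsHomogeneous n)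
    (η : σ → Polynomial L) :
    aeval (fun s => Polynomial.X * η s) F = Polynomial.X ^ n * aeval η F := by
  classical
  simp only [aeval_def, eval₂_eq, Finset.mul_sum]
  refine Finset.sum_congr rfl fun m hm => ?_
  have hdeg : ∑ i ∈ m.support, m i = n := by
    simpa [Finsupp.weight_apply, Finsupp.sum] using hF (mem_support_iff.1 hm)
  simp only [mul_pow, Finset.prod_mul_distrib, Finset.prod_pow_eq_pow_sum, hdeg]
  ring

theorem eval_aeval_polynomial (t : L) (γ : σ → Polynomial L) (F : MvPolynomial σ K) :
    (aeval γ F).eval t = aeval (fun s => (γ s).eval t) F := by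
  have h := MvPolynomial.map_aeval γ (Polynomial.evalRingHom t) F
  rw [Polynomial.coe_evalRingHom] at h
  rw [h, aeval_eq_eval₂Hom]
  congr 2
  ext a
  simp [Polynomial.algebraMap_apply]

/-- If every vector `y` is the velocity at the origin of a polynomial curve `t η(t)` on which `F`
vanishes, then `F = 0`: along such a curve the lowest-order term of `F` is `t ^ n * Fₙ(y)`, where
`Fₙ` is the lowest nonzero homogeneous component of `F`. -/
theorem eq_zero_of_curves_origin [Infinite L] (F : MvPolynomial σ L)
    (h : ∀ y : σ → L, ∃ η : σ → Polynomial L, (∀ s, (η s).eval 0 = y s) ∧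
      aeval (fun s => Polynomial.X * η s) F = 0) : F = 0 := by
  classical
  by_contra hF
  have hex : ∃ n, homogeneousComponent n F ≠ 0 := by
    by_contra! hn
    exact hF (by rw [← sum_homogeneousComponent F]; exact Finset.sum_eq_zero fun i _ => hn i)
  apply Nat.find_spec hex
  set n := Nat.find hex with hn
  refine MvPolynomial.funext fun y => ?_
  obtain ⟨η, hη, h0⟩ := h y
  rw [← sum_homogeneousComponent F, map_sum] at h0
  simp only [aeval_X_mul_of_isHomogeneous (homogeneousComponent_isHomogeneous _ F)] at h0
  have hle : n < F.totalDegree + 1 := by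
    by_contra! hlt
    exact Nat.find_spec hex (homogeneousComponent_eq_zero _ _ hlt)
  have hc := congrArg (fun p => Polynomial.coeff p n) h0
  simp only [Polynomial.finsetSum_coeff, Polynomial.coeff_X_pow_mul', Polynomial.coeff_zero] at hc
  rw [Finset.sum_eq_single n] at hc
  · rw [if_pos le_rfl, Nat.sub_self, Polynomial.coeff_zero_eq_eval_zero,
      eval_aeval_polynomial] at hc
    simpa [hη, aeval_eq_eval] using hc
  · intro i _ hi
    split_ifs with hin
    · have : homogeneousComponent i F = 0 := by
        by_contra hne
        exact Nat.find_min hex (lt_of_le_of_ne hin hi) hne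
      simp [this]
    · rfl
  · intro hnot
    exact absurd (Finset.mem_range.2 hle) hnot

/-- Density criterion: `F` is zero if through some point `x₀` there is, in every direction `y`, a
polynomial curve `γ` such that `F` vanishes at all but finitely many points of `γ`. The exceptional
parameters are roots of `d`; for orbits of linear groups `d` is the determinant of the group
element. -/
theorem eq_zero_of_curves [Infinite L] (F : MvPolynomial σ K) (x₀ : σ → L)
    (h : ∀ y : σ → L, ∃ (γ : σ → Polynomial L) (d : Polynomial L), d ≠ 0 ∧
      (∀ s, (γ s).eval 0 = x₀ s) ∧ (∀ s, (Polynomial.derivative (γ s)).eval 0 = y s) ∧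
      ∀ t, d.eval t ≠ 0 → aeval (fun s => (γ s).eval t) F = 0) : F = 0 := by
  have hinj : Function.Injective (MvPolynomial.map (σ := σ) (algebraMap K L)) :=
    map_injective _ (algebraMap K L).injective
  set G : MvPolynomial σ L :=
    aeval (fun s => X s + C (x₀ s)) (MvPolynomial.map (algebraMap K L) F) with hG
  have hGaeval : ∀ δ : σ → Polynomial L,
      aeval δ G = aeval (fun s => δ s + Polynomial.C (x₀ s)) F := by
    intro δ
    rw [hG, ← AlgHom.comp_apply, comp_aeval, aeval_map_algebraMap]
    simp [← Polynomial.algebraMap_eq]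
  have hG0 : G = 0 := by
    refine eq_zero_of_curves_origin G fun y => ?_
    obtain ⟨γ, d, hd, h0, h1, hF⟩ := h y
    have hdvd : ∀ s, ∃ η, γ s - Polynomial.C (x₀ s) = Polynomial.X * η := by
      intro s
      have : (γ s - Polynomial.C (x₀ s)).coeff 0 = 0 := by
        simp [Polynomial.coeff_zero_eq_eval_zero, h0]
      exact Polynomial.X_dvd_iff.2 this
    choose η hη using hdvd
    refine ⟨η, fun s => ?_, ?_⟩
    · have := congrArg (fun p => (Polynomial.derivative p).eval 0) (hη s)
      simpa [h1] using this.symm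
    · rw [hGaeval]
      simp only [← hη, sub_add_cancel]
      have hprod : d * aeval γ F = 0 := by
        refine Polynomial.funext fun t => ?_
        rw [Polynomial.eval_mul, Polynomial.eval_zero]
        by_cases ht : d.eval t = 0
        · rw [ht, zero_mul]
        · rw [eval_aeval_polynomial, hF t ht, mul_zero]
      exact (mul_eq_zero.1 hprod).resolve_left hd
  refine hinj ?_
  rw [map_zero]
  refine MvPolynomial.funext fun x => ?_
  have := congrArg (eval fun s => x s - x₀ s) hG0
  rw [hG, ← coe_aeval_eq_eval, RingHom.coe_coe, ← AlgHom.comp_apply, comp_aeval] at this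
  simpa [aeval_eq_eval] using this

end Density

/-! ### Discriminants from a pair of invariants -/

section Criterion

variable {K σ : Type*} [Field K]

/-- Invariants are determined by their values on the Weierstrass family (`hzero`), so a discriminant
can only come from the given `c₄` and `c₆`. -/
theorem discriminant_eq_of_invariants (h2 : (2 : K) ≠ 0) (h3 : (3 : K) ≠ 0)
    (inv : ℕ → MvPolynomial σ K → Prop)
    (family : WeierstrassCurve (AlgebraicClosure K) → σ → AlgebraicClosure K)
    (jac : (σ → K) → ClassicalForm K) (α : K) (c₄ c₆ : MvPolynomial σ K)
    (hsub : ∀ k I J, inv k I → inv k J → inv k (I - J))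
    (hzero : ∀ k I, inv k I → (∀ W, aeval (family W) I = 0) → I = 0)
    (h₄ : inv 4 c₄) (h₆ : inv 6 c₆)
    (hW₄ : ∀ W, aeval (family W) c₄ = W.c₄) (hW₆ : ∀ W, aeval (family W) c₆ = W.c₆)
    (he₄ : ∀ φ, eval φ c₄ = α ^ 4 * (jac φ).c₄) (he₆ : ∀ φ, eval φ c₆ = α ^ 6 * (jac φ).c₆) :
    (∃! D : MvPolynomial σ K, IsDiscriminantFor inv family D) ∧
      ∀ D : MvPolynomial σ K, IsDiscriminantFor inv family D →
        ∀ φ : σ → K, eval φ D = α ^ 12 * (jac φ).Δ := by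
  have h1728 : (1728 : K) ≠ 0 := by
    rw [show (1728 : K) = 2 ^ 6 * 3 ^ 3 by norm_num]
    exact mul_ne_zero (pow_ne_zero _ h2) (pow_ne_zero _ h3)
  have hC : (1728 : MvPolynomial σ K) = C 1728 := (map_ofNat C 1728).symm
  have hC0 : (1728 : MvPolynomial σ K) ≠ 0 := by
    rw [hC]
    exact fun h => h1728 (C_eq_zero.1 h)
  have key : ∀ D, IsDiscriminantFor inv family D → 1728 * D = c₄ ^ 3 - c₆ ^ 2 := by
    rintro D ⟨d₄, d₆, ⟨hd₄, hdW₄⟩, ⟨hd₆, hdW₆⟩, hD⟩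
    have e₄ : d₄ = c₄ := sub_eq_zero.1 <| hzero 4 _ (hsub 4 _ _ hd₄ h₄) fun W => by
      rw [map_sub, hdW₄, hW₄, sub_self]
    have e₆ : d₆ = c₆ := sub_eq_zero.1 <| hzero 6 _ (hsub 6 _ _ hd₆ h₆) fun W => by
      rw [map_sub, hdW₆, hW₆, sub_self]
    rw [hD, e₄, e₆]
  refine ⟨⟨C 1728⁻¹ * (c₄ ^ 3 - c₆ ^ 2), ⟨c₄, c₆, ⟨h₄, hW₄⟩, ⟨h₆, hW₆⟩, ?_⟩, ?_⟩, ?_⟩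
  · rw [hC, ← mul_assoc, ← C_mul, mul_inv_cancel₀ h1728, C_1, one_mul]
  · intro D hD
    refine mul_left_cancel₀ hC0 ?_
    rw [key D hD, hC, ← mul_assoc, ← C_mul, mul_inv_cancel₀ h1728, C_1, one_mul]
  · intro D hD φ
    have h := congrArg (eval φ) (key D hD)
    rw [map_mul, map_sub, map_pow, map_pow, he₄, he₆, map_ofNat] at h
    refine mul_left_cancel₀ h1728 ?_
    rw [h, ClassicalForm.Δ]
    field_simp

end Criterion

/-! ### Binary quartics -/

section BinaryQuartic

/-- The invariant `12ae - 3bd + c²` of the binary quartic `∑ f i x^(4-i) z^i`. -/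
def binaryI {R : Type*} [CommRing R] (f : Fin 5 → R) : R :=
  12 * f 0 * f 4 - 3 * f 1 * f 3 + f 2 ^ 2

/-- The invariant `72ace - 27ad² - 27b²e + 9bcd - 2c³` of the binary quartic
`∑ f i x^(4-i) z^i`. -/
def binaryJ {R : Type*} [CommRing R] (f : Fin 5 → R) : R :=
  72 * f 0 * f 2 * f 4 - 27 * f 0 * f 3 ^ 2 - 27 * f 1 ^ 2 * f 4 + 9 * f 1 * f 2 * f 3 - 2 * f 2 ^ 3

/-- The value at `(x, z)` of the binary quartic with coefficients `f`. -/
def binaryEval {R : Type*} [CommRing R] (f : Fin 5 → R) (x z : R) : R :=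
  f 0 * x ^ 4 + f 1 * x ^ 3 * z + f 2 * x ^ 2 * z ^ 2 + f 3 * x * z ^ 3 + f 4 * z ^ 4

/-- The coefficients of the quartic `f (B₀₀ x + B₀₁ z, B₁₀ x + B₁₁ z)`. -/
def binarySubst {R : Type*} [CommRing R] (B : Matrix (Fin 2) (Fin 2) R) (f : Fin 5 → R) :
    Fin 5 → R :=
  let p := B 0 0
  let q := B 0 1
  let r := B 1 0
  let s := B 1 1
  ![f 0 * p ^ 4 + f 1 * p ^ 3 * r + f 2 * p ^ 2 * r ^ 2 + f 3 * p * r ^ 3 + f 4 * r ^ 4,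
    4 * f 0 * p ^ 3 * q + f 1 * (p ^ 3 * s + 3 * p ^ 2 * q * r)
      + f 2 * (2 * p ^ 2 * r * s + 2 * p * q * r ^ 2) + f 3 * (q * r ^ 3 + 3 * p * r ^ 2 * s)
      + 4 * f 4 * r ^ 3 * s,
    6 * f 0 * p ^ 2 * q ^ 2 + f 1 * (3 * p ^ 2 * q * s + 3 * p * q ^ 2 * r)
      + f 2 * (p ^ 2 * s ^ 2 + 4 * p * q * r * s + q ^ 2 * r ^ 2)
      + f 3 * (3 * p * r * s ^ 2 + 3 * q * r ^ 2 * s) + 6 * f 4 * r ^ 2 * s ^ 2,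
    4 * f 0 * p * q ^ 3 + f 1 * (q ^ 3 * r + 3 * p * q ^ 2 * s)
      + f 2 * (2 * p * q * s ^ 2 + 2 * q ^ 2 * r * s) + f 3 * (p * s ^ 3 + 3 * q * r * s ^ 2)
      + 4 * f 4 * r * s ^ 3,
    f 0 * q ^ 4 + f 1 * q ^ 3 * s + f 2 * q ^ 2 * s ^ 2 + f 3 * q * s ^ 3 + f 4 * s ^ 4]

variable {R S : Type*} [CommRing R] [CommRing S]

theorem binaryEval_smul (c : R) (f : Fin 5 → R) (x z : R) :
    binaryEval (c • f) x z = c * binaryEval f x z := by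
  simp only [binaryEval, Pi.smul_apply, smul_eq_mul]; ring

theorem binaryI_smul (c : R) (f : Fin 5 → R) : binaryI (c • f) = c ^ 2 * binaryI f := by
  simp only [binaryI, Pi.smul_apply, smul_eq_mul]; ring

theorem binaryJ_smul (c : R) (f : Fin 5 → R) : binaryJ (c • f) = c ^ 3 * binaryJ f := by
  simp only [binaryJ, Pi.smul_apply, smul_eq_mul]; ring

theorem map_binaryI {F : Type*} [FunLike F R S] [RingHomClass F R S] (g : F) (f : Fin 5 → R) :
    g (binaryI f) = binaryI fun i => g (f i) := by
  simp [binaryI, map_ofNat g]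

theorem map_binaryJ {F : Type*} [FunLike F R S] [RingHomClass F R S] (g : F) (f : Fin 5 → R) :
    g (binaryJ f) = binaryJ fun i => g (f i) := by
  simp [binaryJ, map_ofNat g]

theorem binaryEval_binarySubst (B : Matrix (Fin 2) (Fin 2) R) (f : Fin 5 → R) (x z : R) :
    binaryEval (binarySubst B f) x z =
      binaryEval f (B 0 0 * x + B 0 1 * z) (B 1 0 * x + B 1 1 * z) := by
  simp [binaryEval, binarySubst]; ring

theorem binaryI_binarySubst (B : Matrix (Fin 2) (Fin 2) R) (f : Fin 5 → R) :
    binaryI (binarySubst B f) = B.det ^ 4 * binaryI f := by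
  simp [binaryI, binarySubst, Matrix.det_fin_two]; ring

theorem binaryJ_binarySubst (B : Matrix (Fin 2) (Fin 2) R) (f : Fin 5 → R) :
    binaryJ (binarySubst B f) = B.det ^ 6 * binaryJ f := by
  simp [binaryJ, binarySubst, Matrix.det_fin_two]; ring

/-- Over an infinite field a binary quartic is determined by its values on the affine line `z = 1`. -/
theorem binaryEval_injective {L : Type*} [Field L] [Infinite L] {f g : Fin 5 → L}
    (h : ∀ x, binaryEval f x 1 = binaryEval g x 1) : f = g := by
  let P : (Fin 5 → L) → Polynomial L := fun f =>
    binaryEval (fun i => Polynomial.C (f i)) Polynomial.X 1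
  have hP : P f = P g := Polynomial.funext fun x => by
    simpa [P, binaryEval] using h x
  ext i
  fin_cases i
  · simpa [P, binaryEval, Polynomial.coeff_X, Polynomial.coeff_C] using
      congrArg (fun p => Polynomial.coeff p 4) hP
  · simpa [P, binaryEval, Polynomial.coeff_X, Polynomial.coeff_C] using
      congrArg (fun p => Polynomial.coeff p 3) hP
  · simpa [P, binaryEval, Polynomial.coeff_X, Polynomial.coeff_C] using
      congrArg (fun p => Polynomial.coeff p 2) hP
  · simpa [P, binaryEval, Polynomial.coeff_X, Polynomial.coeff_C] using
      congrArg (fun p => Polynomial.coeff p 1) hP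
  · simpa [P, binaryEval, Polynomial.coeff_X, Polynomial.coeff_C] using
      congrArg (fun p => Polynomial.coeff p 0) hP

end BinaryQuartic

/-! ### Linear substitutions and the cuspidal Weierstrass curve -/

theorem eval_linSubst {ι R : Type*} [Fintype ι] [CommRing R] (B : Matrix ι ι R) (v : ι → R)
    (p : MvPolynomial ι R) :
    eval v (linSubst B p) = eval (fun i => ∑ j, B i j * v j) p := by
  have h : (aeval v).comp (linSubst B) = aeval (R := R) fun i => ∑ j, B i j * v j := by
    ext i
    simp [linSubst]
  simpa [aeval_eq_eval] using DFunLike.congr_fun h p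

theorem linSubst_mul {ι R : Type*} [Fintype ι] [CommRing R] (M N : Matrix ι ι R)
    (p : MvPolynomial ι R) :
    linSubst (M * N) p = linSubst N (linSubst M p) := by
  have h : linSubst (M * N) = (linSubst N).comp (linSubst M) := by
    ext1 i
    simp only [linSubst, aeval_X, AlgHom.comp_apply, map_sum, map_mul, algHom_C,
      MvPolynomial.algebraMap_eq, Matrix.mul_apply, Finset.sum_mul, Finset.mul_sum]
    rw [Finset.sum_comm]
    simp only [mul_assoc]
  rw [h, AlgHom.comp_apply]

theorem ofNat_ne_zero_of_algebra {K : Type*} (L : Type*) [Field K] [Field L] [Algebra K L] {n : ℕ}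
    [n.AtLeastTwo] (h : (OfNat.ofNat n : K) ≠ 0) : (OfNat.ofNat n : L) ≠ 0 := by
  rw [← map_ofNat (algebraMap K L) n]
  exact (map_ne_zero _).2 h

/-- The cuspidal Weierstrass curve `y² = x³` deformed in the directions of `a₄` and `a₆`. -/
def cuspDeformation {R : Type*} [CommRing R] (a₄ a₆ : R) : WeierstrassCurve R :=
  ⟨0, 0, 0, a₄, a₆⟩

/-! ### Models of degree 2 -/

section Degree2

variable {R S : Type*} [CommRing R] [CommRing S]

/-- The coefficients of the quartic `4q + p²` obtained by completing the square. -/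
def completedQuartic (φ : Coord2 → R) : Fin 5 → R :=
  ![4 * φ .a + φ .α₀ ^ 2, 4 * φ .b + 2 * φ .α₀ * φ .α₁,
    4 * φ .c + φ .α₁ ^ 2 + 2 * φ .α₀ * φ .α₂, 4 * φ .d + 2 * φ .α₁ * φ .α₂,
    4 * φ .e + φ .α₂ ^ 2]

theorem map_completedQuartic {F : Type*} [FunLike F R S] [RingHomClass F R S] (g : F)
    (φ : Coord2 → R) (i : Fin 5) :
    g (completedQuartic φ i) = completedQuartic (fun s => g (φ s)) i := by
  fin_cases i <;> simp [completedQuartic, map_ofNat g]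

theorem binaryEval_completedQuartic (φ : Coord2 → R) (x z : R) :
    binaryEval (completedQuartic φ) x z =
      4 * eval ![x, z] (quarticForm φ) + eval ![x, z] (quadraticForm φ) ^ 2 := by
  simp [binaryEval, completedQuartic, quarticForm, quadraticForm]; ring

/-- The part `r` of a transformation disappears on completing the square. -/
theorem Transforms2.completedQuartic_eq {L : Type*} [Field L] [Infinite L] {μ : L} {r : Fin 3 → L}
    {B : Matrix (Fin 2) (Fin 2) L} {φ φ' : Coord2 → L} (h : Transforms2 μ r B φ φ') :
    completedQuartic φ' = μ ^ 2 • binarySubst B (completedQuartic φ) := by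
  obtain ⟨hp, hq⟩ := h
  refine binaryEval_injective fun x => ?_
  have hv : (fun i => ∑ j, B i j * (![x, 1] : Fin 2 → L) j) =
      ![B 0 0 * x + B 0 1 * 1, B 1 0 * x + B 1 1 * 1] := by
    ext i; fin_cases i <;> simp [Fin.sum_univ_two]
  rw [binaryEval_smul, binaryEval_binarySubst, binaryEval_completedQuartic, binaryEval_completedQuartic,
    hp, hq]
  simp only [map_add, map_sub, map_mul, map_pow, eval_linSubst, hv, eval_C, eval_X, map_ofNat]
  ring

/-- The model `(2r, q ∘ B - r²)`, where `q = x³z + a₄xz³ + a₆z⁴`: the transform by `[1, r, B]` of the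
model of `y² = x³ + a₄x + a₆`. -/
def cuspOrbit2 (r : Fin 3 → R) (B : Matrix (Fin 2) (Fin 2) R) (a₄ a₆ : R) : Coord2 → R
  | .α₀ => 2 * r 0
  | .α₁ => 2 * r 1
  | .α₂ => 2 * r 2
  | .a => binarySubst B ![0, 1, 0, a₄, a₆] 0 - r 0 ^ 2
  | .b => binarySubst B ![0, 1, 0, a₄, a₆] 1 - 2 * r 0 * r 1
  | .c => binarySubst B ![0, 1, 0, a₄, a₆] 2 - r 1 ^ 2 - 2 * r 0 * r 2
  | .d => binarySubst B ![0, 1, 0, a₄, a₆] 3 - 2 * r 1 * r 2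
  | .e => binarySubst B ![0, 1, 0, a₄, a₆] 4 - r 2 ^ 2

theorem map_cuspOrbit2 (g : R →+* S) (r : Fin 3 → R) (B : Matrix (Fin 2) (Fin 2) R) (a₄ a₆ : R) :
    (fun s => g (cuspOrbit2 r B a₄ a₆ s)) =
      cuspOrbit2 (fun i => g (r i)) (B.map g) (g a₄) (g a₆) := by
  ext s; cases s <;> simp [cuspOrbit2, binarySubst, map_ofNat g]

theorem transforms2_cuspOrbit2 (r : Fin 3 → R) (B : Matrix (Fin 2) (Fin 2) R) (a₄ a₆ : R) :
    Transforms2 1 r B (weierstrass2 (cuspDeformation a₄ a₆)) (cuspOrbit2 r B a₄ a₆) := by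
  constructor
  · simp [quadraticForm, weierstrass2, cuspDeformation, cuspOrbit2,
      map_ofNat (C : R →+* MvPolynomial (Fin 2) R)]
    ring
  · simp [quadraticForm, quarticForm, weierstrass2, cuspDeformation, cuspOrbit2, binarySubst,
      linSubst, Fin.sum_univ_two, map_ofNat (C : R →+* MvPolynomial (Fin 2) R)]
    ring

variable {K : Type*} [Field K]

theorem IsInvariant2.sub {k : ℕ} {I J : MvPolynomial Coord2 K} (hI : IsInvariant2 k I)
    (hJ : IsInvariant2 k J) : IsInvariant2 k (I - J) := by
  intro μ r B φ φ' h
  rw [map_sub, map_sub, hI μ r B φ φ' h, hJ μ r B φ φ' h, mul_sub]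

/-- The orbits of the curves `y² = x³ + a₄x + a₆` are dense in `X_2`: their tangent directions at the
cuspidal model `y² = x³z` span the space. Since `∂(x³z)/∂x = 3x²z` and `∂(x³z)/∂z = x³`, the group
yields every `p` and the quartic monomials `x⁴, x³z, x²z²`; the deformations `a₄`, `a₆` yield `xz³`
and `z⁴`. -/
theorem eq_zero_of_cuspOrbit2 {L : Type*} [Field L] [Infinite L] [Algebra K L]
    (h2 : (2 : L) ≠ 0) (h3 : (3 : L) ≠ 0) (I : MvPolynomial Coord2 K)
    (h : ∀ (r : Fin 3 → L) (B : Matrix (Fin 2) (Fin 2) L) (a₄ a₆ : L), B.det ≠ 0 →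
      aeval (cuspOrbit2 r B a₄ a₆) I = 0) : I = 0 := by
  refine eq_zero_of_curves (L := L) I (weierstrass2 (cuspDeformation 0 0)) fun y => ?_
  let r : Fin 3 → Polynomial L :=
    ![Polynomial.X * Polynomial.C (y .α₀ / 2), Polynomial.X * Polynomial.C (y .α₁ / 2),
      Polynomial.X * Polynomial.C (y .α₂ / 2)]
  let B : Matrix (Fin 2) (Fin 2) (Polynomial L) :=
    !![1, Polynomial.X * Polynomial.C (y .c / 3);
       Polynomial.X * Polynomial.C (y .a), 1 + Polynomial.X * Polynomial.C (y .b)]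
  let a₄ : Polynomial L := Polynomial.X * Polynomial.C (y .d)
  let a₆ : Polynomial L := Polynomial.X * Polynomial.C (y .e)
  refine ⟨cuspOrbit2 r B a₄ a₆, B.det, ?_, ?_, ?_, ?_⟩
  · intro hB
    have := congrArg (Polynomial.eval 0) hB
    simp [B, Matrix.det_fin_two] at this
  · intro s
    cases s <;> simp [cuspOrbit2, binarySubst, weierstrass2, cuspDeformation, r, B, a₄, a₆]
  · intro s
    cases s <;> simp [cuspOrbit2, binarySubst, r, B, a₄, a₆, Polynomial.derivative_pow] <;>
      field_simp
  · intro t ht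
    have hm := map_cuspOrbit2 (Polynomial.evalRingHom t) r B a₄ a₆
    have hdet : (B.map (Polynomial.evalRingHom t)).det ≠ 0 := by
      rwa [← RingHom.mapMatrix_apply, ← RingHom.map_det]
    rw [Polynomial.coe_evalRingHom] at hm
    rw [hm]
    exact h _ _ _ _ hdet

theorem IsInvariant2.eq_zero_of_weierstrass (h2 : (2 : K) ≠ 0) (h3 : (3 : K) ≠ 0) {k : ℕ}
    {I : MvPolynomial Coord2 K} (hI : IsInvariant2 k I)
    (h : ∀ W : WeierstrassCurve (AlgebraicClosure K), aeval (weierstrass2 W) I = 0) : I = 0 := by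
  refine eq_zero_of_cuspOrbit2 (ofNat_ne_zero_of_algebra (AlgebraicClosure K) h2)
    (ofNat_ne_zero_of_algebra (AlgebraicClosure K) h3) I fun r B a₄ a₆ hB => ?_
  have := hI 1 r (Matrix.GeneralLinearGroup.mkOfDetNeZero B hB) _ _
    (transforms2_cuspOrbit2 r B a₄ a₆)
  rwa [h, mul_zero] at this

theorem discriminant_degree_two (h2 : (2 : K) ≠ 0) (h3 : (3 : K) ≠ 0) :
    (∃! D : MvPolynomial Coord2 K, IsDiscriminant2 D) ∧
      ∀ D : MvPolynomial Coord2 K, IsDiscriminant2 D →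
        ∀ φ : Coord2 → K, eval φ D = (1 : K) ^ 12 * (jacobian2 φ).Δ := by
  have h2L := ofNat_ne_zero_of_algebra (AlgebraicClosure K) h2
  have h4 : (4 : K) ≠ 0 := by rw [show (4 : K) = 2 ^ 2 by norm_num]; simp [h2]
  have h12 : (12 : K) ≠ 0 := by rw [show (12 : K) = 2 ^ 2 * 3 by norm_num]; simp [h2, h3]
  have h432 : (432 : K) ≠ 0 := by
    rw [show (432 : K) = 2 ^ 4 * 3 ^ 3 by norm_num]; simp [h2, h3]
  refine discriminant_eq_of_invariants h2 h3 IsInvariant2 weierstrass2 jacobian2 1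
    (binaryI (completedQuartic X)) (C 2⁻¹ * binaryJ (completedQuartic X))
    (fun k I J => IsInvariant2.sub) (fun k I => IsInvariant2.eq_zero_of_weierstrass h2 h3)
    ?_ ?_ ?_ ?_ ?_ ?_
  · intro μ r B φ φ' h
    simp only [map_binaryI, map_completedQuartic, aeval_X]
    rw [h.completedQuartic_eq, binaryI_smul, binaryI_binarySubst]
    ring
  · intro μ r B φ φ' h
    simp only [map_mul, map_binaryJ, map_completedQuartic, aeval_X, aeval_C, map_inv₀,
      map_ofNat (algebraMap K (AlgebraicClosure K))]
    rw [h.completedQuartic_eq, binaryJ_smul, binaryJ_binarySubst]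
    ring
  · intro W
    simp only [map_binaryI, map_completedQuartic, aeval_X]
    simp [binaryI, completedQuartic, weierstrass2, WeierstrassCurve.c₄, WeierstrassCurve.b₂,
      WeierstrassCurve.b₄]
    ring
  · intro W
    simp only [map_mul, map_binaryJ, map_completedQuartic, aeval_X, aeval_C, map_inv₀,
      map_ofNat (algebraMap K (AlgebraicClosure K))]
    simp [binaryJ, completedQuartic, weierstrass2, WeierstrassCurve.c₆, WeierstrassCurve.b₂,
      WeierstrassCurve.b₄, WeierstrassCurve.b₆]
    field_simp
    ring
  · intro φ
    simp only [map_binaryI, map_completedQuartic, eval_X]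
    simp [binaryI, completedQuartic, jacobian2, ClassicalForm.c₄, quarticI]
    field_simp
    ring
  · intro φ
    simp only [map_mul, map_binaryJ, map_completedQuartic, eval_X]
    simp [binaryJ, completedQuartic, jacobian2, ClassicalForm.c₆, quarticJ]
    field_simp
    ring

end Degree2

/-! ### Ternary cubics -/

section TernaryCubic

/-- The Aronhold invariant `S`, given by the formula of `aronholdS`, over any commutative ring. -/
def ternaryS {R : Type*} [CommRing R] (a b c a₂ a₃ b₁ b₃ c₁ c₂ m : R) : R :=
  a*b*c*m - (b*c*a₂*a₃ + c*a*b₁*b₃ + a*b*c₁*c₂)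
  - m*(a*b₃*c₂ + b*c₁*a₃ + c*a₂*b₁)
  + (a*b₁*c₂^2 + a*c₁*b₃^2 + b*a₂*c₁^2 + b*c₂*a₃^2 + c*b₃*a₂^2 + c*a₃*b₁^2)
  - m^4 + 2*m^2*(b₁*c₁ + c₂*a₂ + a₃*b₃)
  - 3*m*(a₂*b₃*c₁ + a₃*b₁*c₂)
  - (b₁^2*c₁^2 + c₂^2*a₂^2 + a₃^2*b₃^2)
  + (c₂*a₂*a₃*b₃ + a₃*b₃*b₁*c₁ + b₁*c₁*c₂*a₂)

/-- The Aronhold invariant `T`, given by the formula of `aronholdT`, over any commutative ring. -/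
def ternaryT {R : Type*} [CommRing R] (a b c a₂ a₃ b₁ b₃ c₁ c₂ m : R) : R :=
  a^2*b^2*c^2 - 6*a*b*c*(a*b₃*c₂ + b*c₁*a₃ + c*a₂*b₁) - 20*a*b*c*m^3
  + 12*a*b*c*m*(b₁*c₁ + c₂*a₂ + a₃*b₃) + 6*a*b*c*(a₂*b₃*c₁ + a₃*b₁*c₂)
  + 4*(a^2*b*c₂^3 + a^2*c*b₃^3 + b^2*c*a₃^3 + b^2*a*c₁^3 + c^2*a*b₁^3 + c^2*b*a₂^3)
  + 36*m^2*(b*c*a₂*a₃ + c*a*b₁*b₃ + a*b*c₁*c₂)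
  - 24*m*(b*c*b₁*a₃^2 + b*c*c₁*a₂^2 + c*a*c₂*b₁^2 + c*a*a₂*b₃^2 + a*b*a₃*c₂^2 + a*b*b₃*c₁^2)
  - 3*(a^2*b₃^2*c₂^2 + b^2*c₁^2*a₃^2 + c^2*a₂^2*b₁^2)
  + 18*(b*c*b₁*c₁*a₂*a₃ + c*a*c₂*a₂*b₃*b₁ + a*b*a₃*b₃*c₁*c₂)
  - 12*(b*c*c₂*a₃*a₂^2 + b*c*b₃*a₂*a₃^2 + c*a*c₁*b₃*b₁^2 + c*a*a₃*b₁*b₃^2 + a*b*a₂*c₁*c₂^2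
      + a*b*b₁*c₂*c₁^2)
  - 12*m^3*(a*b₃*c₂ + b*c₁*a₃ + c*a₂*b₁)
  + 12*m^2*(a*b₁*c₂^2 + a*c₁*b₃^2 + b*a₂*c₁^2 + b*c₂*a₃^2 + c*b₃*a₂^2 + c*a₃*b₁^2)
  - 60*m*(a*b₁*b₃*c₁*c₂ + b*c₁*c₂*a₂*a₃ + c*a₂*a₃*b₁*b₃)
  + 12*m*(a*a₂*b₃*c₂^2 + a*a₃*c₂*b₃^2 + b*b₃*c₁*a₃^2 + b*b₁*a₃*c₁^2 + c*c₁*a₂*b₁^2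
      + c*c₂*b₁*a₂^2)
  + 6*(a*b₃*c₂ + b*c₁*a₃ + c*a₂*b₁)*(a₂*b₃*c₁ + a₃*b₁*c₂)
  + 24*(a*b₁*b₃^2*c₁^2 + a*c₁*c₂^2*b₁^2 + b*c₂*c₁^2*a₂^2 + b*a₂*a₃^2*c₂^2 + c*a₃*a₂^2*b₃^2
      + c*b₃*b₁^2*a₃^2)
  - 12*(a*a₂*b₁*c₂^3 + a*a₃*c₁*b₃^3 + b*b₃*c₂*a₃^3 + b*b₁*a₂*c₁^3 + c*c₁*a₃*b₁^3 + c*c₂*b₃*a₂^3)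
  - 8*m^6 + 24*m^4*(b₁*c₁ + c₂*a₂ + a₃*b₃) - 36*m^3*(a₂*b₃*c₁ + a₃*b₁*c₂)
  - 12*m^2*(b₁*c₁*c₂*a₂ + c₂*a₂*a₃*b₃ + a₃*b₃*b₁*c₁)
  - 24*m^2*(b₁^2*c₁^2 + c₂^2*a₂^2 + a₃^2*b₃^2)
  + 36*m*(a₂*b₃*c₁ + a₃*b₁*c₂)*(b₁*c₁ + c₂*a₂ + a₃*b₃)
  + 8*(b₁^3*c₁^3 + c₂^3*a₂^3 + a₃^3*b₃^3)
  - 27*(a₂^2*b₃^2*c₁^2 + a₃^2*b₁^2*c₂^2)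
  - 6*b₁*c₁*c₂*a₂*a₃*b₃
  - 12*(b₁^2*c₁^2*c₂*a₂ + b₁^2*c₁^2*a₃*b₃ + c₂^2*a₂^2*a₃*b₃ + c₂^2*a₂^2*b₁*c₁
      + a₃^2*b₃^2*b₁*c₁ + a₃^2*b₃^2*c₂*a₂)

variable {R S : Type*} [CommRing R] [CommRing S]

/-- The value of a ternary cubic at `u`. -/
def cubicEval (φ : Coord3 → R) (u : Fin 3 → R) : R :=
  φ .a * u 0 ^ 3 + φ .b * u 1 ^ 3 + φ .c * u 2 ^ 3 + φ .a₂ * u 0 ^ 2 * u 1 + φ .a₃ * u 0 ^ 2 * u 2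
    + φ .b₁ * u 0 * u 1 ^ 2 + φ .b₃ * u 1 ^ 2 * u 2 + φ .c₁ * u 0 * u 2 ^ 2
    + φ .c₂ * u 1 * u 2 ^ 2 + φ .m * u 0 * u 1 * u 2

/-- The coefficient of `s²t` in the value of a ternary cubic at `su + tv`. -/
def cubicPolar (φ : Coord3 → R) (u v : Fin 3 → R) : R :=
  φ .a * (3 * u 0 ^ 2 * v 0) + φ .b * (3 * u 1 ^ 2 * v 1) + φ .c * (3 * u 2 ^ 2 * v 2)
    + φ .a₂ * (u 0 ^ 2 * v 1 + 2 * u 0 * u 1 * v 0)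
    + φ .a₃ * (u 0 ^ 2 * v 2 + 2 * u 0 * u 2 * v 0)
    + φ .b₁ * (2 * u 0 * u 1 * v 1 + u 1 ^ 2 * v 0)
    + φ .b₃ * (u 1 ^ 2 * v 2 + 2 * u 1 * u 2 * v 1)
    + φ .c₁ * (2 * u 0 * u 2 * v 2 + u 2 ^ 2 * v 0)
    + φ .c₂ * (2 * u 1 * u 2 * v 2 + u 2 ^ 2 * v 1)
    + φ .m * (u 0 * u 1 * v 2 + u 0 * u 2 * v 1 + u 1 * u 2 * v 0)

/-- The coefficient of `rst` in the value of a ternary cubic at `ru + sv + tw`. -/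
def cubicPolarization (φ : Coord3 → R) (u v w : Fin 3 → R) : R :=
  φ .a * (6 * u 0 * v 0 * w 0) + φ .b * (6 * u 1 * v 1 * w 1) + φ .c * (6 * u 2 * v 2 * w 2)
    + φ .a₂ * (2 * u 0 * v 0 * w 1 + 2 * u 0 * v 1 * w 0 + 2 * u 1 * v 0 * w 0)
    + φ .a₃ * (2 * u 0 * v 0 * w 2 + 2 * u 0 * v 2 * w 0 + 2 * u 2 * v 0 * w 0)
    + φ .b₁ * (2 * u 0 * v 1 * w 1 + 2 * u 1 * v 0 * w 1 + 2 * u 1 * v 1 * w 0)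
    + φ .b₃ * (2 * u 1 * v 1 * w 2 + 2 * u 1 * v 2 * w 1 + 2 * u 2 * v 1 * w 1)
    + φ .c₁ * (2 * u 0 * v 2 * w 2 + 2 * u 2 * v 0 * w 2 + 2 * u 2 * v 2 * w 0)
    + φ .c₂ * (2 * u 1 * v 2 * w 2 + 2 * u 2 * v 1 * w 2 + 2 * u 2 * v 2 * w 1)
    + φ .m * (u 0 * v 1 * w 2 + u 0 * v 2 * w 1 + u 1 * v 0 * w 2 + u 1 * v 2 * w 0 + u 2 * v 0 * w 1 + u 2 * v 1 * w 0)

/-- The coefficients of the ternary cubic `φ ∘ B`. -/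
def cubicSubst (B : Matrix (Fin 3) (Fin 3) R) (φ : Coord3 → R) : Coord3 → R
  | .a => cubicEval φ (B.col 0)
  | .b => cubicEval φ (B.col 1)
  | .c => cubicEval φ (B.col 2)
  | .a₂ => cubicPolar φ (B.col 0) (B.col 1)
  | .a₃ => cubicPolar φ (B.col 0) (B.col 2)
  | .b₁ => cubicPolar φ (B.col 1) (B.col 0)
  | .b₃ => cubicPolar φ (B.col 1) (B.col 2)
  | .c₁ => cubicPolar φ (B.col 2) (B.col 0)
  | .c₂ => cubicPolar φ (B.col 2) (B.col 1)
  | .m => cubicPolarization φ (B.col 0) (B.col 1) (B.col 2)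

/-- `6⁴ S`, a polynomial in the coefficients of a model of degree 3 over any commutative ring. -/
def scaledS (φ : Coord3 → R) : R :=
  ternaryS (6 * φ .a) (6 * φ .b) (6 * φ .c) (2 * φ .a₂) (2 * φ .a₃) (2 * φ .b₁) (2 * φ .b₃)
    (2 * φ .c₁) (2 * φ .c₂) (φ .m)

/-- `6⁶ T`, a polynomial in the coefficients of a model of degree 3 over any commutative ring. -/
def scaledT (φ : Coord3 → R) : R :=
  ternaryT (6 * φ .a) (6 * φ .b) (6 * φ .c) (2 * φ .a₂) (2 * φ .a₃) (2 * φ .b₁) (2 * φ .b₃)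
    (2 * φ .c₁) (2 * φ .c₂) (φ .m)

theorem map_scaledS {F : Type*} [FunLike F R S] [RingHomClass F R S] (g : F) (φ : Coord3 → R) :
    g (scaledS φ) = scaledS fun s => g (φ s) := by
  simp only [scaledS, ternaryS, map_add, map_sub, map_mul, map_pow, map_ofNat g]

theorem map_scaledT {F : Type*} [FunLike F R S] [RingHomClass F R S] (g : F) (φ : Coord3 → R) :
    g (scaledT φ) = scaledT fun s => g (φ s) := by
  simp only [scaledT, ternaryT, map_add, map_sub, map_mul, map_pow, map_ofNat g]

theorem map_cubicSubst (g : R →+* S) (B : Matrix (Fin 3) (Fin 3) R) (φ : Coord3 → R) :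
    (fun s => g (cubicSubst B φ s)) = cubicSubst (B.map g) fun s => g (φ s) := by
  ext s
  cases s <;> simp [cubicSubst, cubicEval, cubicPolar, cubicPolarization, map_ofNat g]

theorem cubicForm_cubicSubst (B : Matrix (Fin 3) (Fin 3) R) (φ : Coord3 → R) :
    cubicForm (cubicSubst B φ) = linSubst B (cubicForm φ) := by
  simp only [cubicForm, cubicSubst, cubicEval, cubicPolar, cubicPolarization, linSubst,
    Fin.sum_univ_three, Matrix.col_apply, map_add, map_mul, map_pow, aeval_X, algHom_C,
    MvPolynomial.algebraMap_eq, map_ofNat (C : R →+* MvPolynomial (Fin 3) R)]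
  ring

theorem cubicForm_smul (c : R) (φ : Coord3 → R) : cubicForm (c • φ) = C c * cubicForm φ := by
  simp only [cubicForm, Pi.smul_apply, smul_eq_mul, map_mul]
  ring

theorem cubicForm_injective {L : Type*} [Field L] (h2 : (2 : L) ≠ 0) :
    Function.Injective (cubicForm (R := L)) := by
  intro φ φ' h
  have key : ∀ v : Fin 3 → L, cubicEval φ v = cubicEval φ' v := fun v => by
    have := congrArg (eval v) h
    simp [cubicForm] at this
    simp only [cubicEval]
    linear_combination this
  have e0 := key ![1, 0, 0]
  have e1 := key ![0, 1, 0]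
  have e2 := key ![0, 0, 1]
  have e3 := key ![1, 1, 0]
  have e4 := key ![1, -1, 0]
  have e5 := key ![1, 0, 1]
  have e6 := key ![1, 0, -1]
  have e7 := key ![0, 1, 1]
  have e8 := key ![0, 1, -1]
  have e9 := key ![1, 1, 1]
  simp only [cubicEval, Matrix.cons_val] at e0 e1 e2 e3 e4 e5 e6 e7 e8 e9
  ext s
  cases s <;> refine mul_left_cancel₀ h2 ?_
  · linear_combination 2 * e0
  · linear_combination 2 * e1
  · linear_combination 2 * e2
  · linear_combination e3 - e4 - 2 * e1
  · linear_combination e5 - e6 - 2 * e2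
  · linear_combination e3 + e4 - 2 * e0
  · linear_combination e7 - e8 - 2 * e2
  · linear_combination e5 + e6 - 2 * e0
  · linear_combination e7 + e8 - 2 * e1
  · linear_combination 2 * e9 - 2 * e3 - 2 * e5 - 2 * e7 + 2 * e0 + 2 * e1 + 2 * e2

theorem cubicSubst_mul {L : Type*} [Field L] (h2 : (2 : L) ≠ 0) (M N : Matrix (Fin 3) (Fin 3) L)
    (φ : Coord3 → L) : cubicSubst (M * N) φ = cubicSubst N (cubicSubst M φ) :=
  cubicForm_injective h2 <| by simp only [cubicForm_cubicSubst, linSubst_mul]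

theorem scaledS_smul (c : R) (φ : Coord3 → R) : scaledS (c • φ) = c ^ 4 * scaledS φ := by
  simp only [scaledS, ternaryS, Pi.smul_apply, smul_eq_mul]
  ring

theorem scaledT_smul (c : R) (φ : Coord3 → R) : scaledT (c • φ) = c ^ 6 * scaledT φ := by
  simp only [scaledT, ternaryT, Pi.smul_apply, smul_eq_mul]
  ring

theorem scaledS_diagonal (d : Fin 3 → R) (φ : Coord3 → R) :
    scaledS (cubicSubst (Matrix.diagonal d) φ) = (Matrix.diagonal d).det ^ 4 * scaledS φ := by
  simp [scaledS, ternaryS, cubicSubst, cubicEval, cubicPolar, cubicPolarization,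
    Fin.prod_univ_three]
  ring

theorem scaledT_diagonal (d : Fin 3 → R) (φ : Coord3 → R) :
    scaledT (cubicSubst (Matrix.diagonal d) φ) = (Matrix.diagonal d).det ^ 6 * scaledT φ := by
  simp [scaledT, ternaryT, cubicSubst, cubicEval, cubicPolar, cubicPolarization,
    Fin.prod_univ_three]
  ring

theorem scaledS_transvection {i j : Fin 3} (hij : i ≠ j) (c : R) (φ : Coord3 → R) :
    scaledS (cubicSubst (Matrix.transvection i j c) φ) = scaledS φ := by
  fin_cases i <;> fin_cases j <;> first | exact absurd rfl hij |
    (simp [scaledS, ternaryS, cubicSubst, cubicEval, cubicPolar, cubicPolarization,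
      Matrix.transvection]
     ring)

theorem scaledT_transvection {i j : Fin 3} (hij : i ≠ j) (c : R) (φ : Coord3 → R) :
    scaledT (cubicSubst (Matrix.transvection i j c) φ) = scaledT φ := by
  fin_cases i <;> fin_cases j <;> first | exact absurd rfl hij |
    (simp [scaledT, ternaryT, cubicSubst, cubicEval, cubicPolar, cubicPolarization,
      Matrix.transvection]
     ring)

/-- `S` and `T` are invariants of weights 4 and 6 for `GL₃`, which is generated by transvections and
diagonal matrices. -/
theorem scaled_cubicSubst {L : Type*} [Field L] (h2 : (2 : L) ≠ 0) {B : Matrix (Fin 3) (Fin 3) L}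
    (hB : B.det ≠ 0) : ∀ φ : Coord3 → L,
      scaledS (cubicSubst B φ) = B.det ^ 4 * scaledS φ ∧
      scaledT (cubicSubst B φ) = B.det ^ 6 * scaledT φ := by
  refine Matrix.diagonal_transvection_induction_of_det_ne_zero
    (fun B => ∀ φ : Coord3 → L, scaledS (cubicSubst B φ) = B.det ^ 4 * scaledS φ ∧
      scaledT (cubicSubst B φ) = B.det ^ 6 * scaledT φ) B hB ?_ ?_ ?_
  · exact fun d _ φ => ⟨scaledS_diagonal d φ, scaledT_diagonal d φ⟩
  · intro t φ
    rw [t.det, one_pow, one_pow, one_mul, one_mul]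
    exact ⟨scaledS_transvection t.hij t.c φ, scaledT_transvection t.hij t.c φ⟩
  · intro M N _ _ hM hN φ
    rw [cubicSubst_mul h2, (hN _).1, (hN _).2, (hM _).1, (hM _).2, Matrix.det_mul]
    constructor <;> ring

end TernaryCubic

/-! ### Models of degree 3 -/

section Degree3

variable {K : Type*} [Field K]

theorem Transforms3.eq_smul_cubicSubst {L : Type*} [Field L] (h2 : (2 : L) ≠ 0) {μ : L}
    {B : Matrix (Fin 3) (Fin 3) L} {φ φ' : Coord3 → L} (h : Transforms3 μ B φ φ') :
    φ' = μ • cubicSubst B φ :=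
  cubicForm_injective h2 <| by rw [cubicForm_smul, cubicForm_cubicSubst]; exact h

theorem transforms3_cubicSubst {R : Type*} [CommRing R] (B : Matrix (Fin 3) (Fin 3) R)
    (φ : Coord3 → R) : Transforms3 1 B φ (cubicSubst B φ) := by
  rw [Transforms3, cubicForm_cubicSubst, C_1, one_mul]

theorem IsInvariant3.sub {k : ℕ} {I J : MvPolynomial Coord3 K} (hI : IsInvariant3 k I)
    (hJ : IsInvariant3 k J) : IsInvariant3 k (I - J) := by
  intro μ B φ φ' h
  rw [map_sub, map_sub, hI μ B φ φ' h, hJ μ B φ φ' h, mul_sub]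

theorem map_weierstrass3_cuspDeformation {R S : Type*} [CommRing R] [CommRing S] (g : R →+* S)
    (a₄ a₆ : R) : (fun s => g (weierstrass3 (cuspDeformation a₄ a₆) s)) =
      weierstrass3 (cuspDeformation (g a₄) (g a₆)) := by
  ext s
  cases s <;> simp [weierstrass3, cuspDeformation]

/-- The orbits of the curves `y² = x³ + a₄x + a₆` are dense in `X_3`: their tangent directions at the
cuspidal cubic `y²z - x³` span the space. The partial derivatives `-3x²`, `2yz`, `y²`, multiplied by
linear forms, give all cubic monomials but `xz²` and `z³`, which come from `a₄` and `a₆`. -/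
theorem eq_zero_of_cuspOrbit3 {L : Type*} [Field L] [Infinite L] [Algebra K L]
    (h2 : (2 : L) ≠ 0) (h3 : (3 : L) ≠ 0) (I : MvPolynomial Coord3 K)
    (h : ∀ (B : Matrix (Fin 3) (Fin 3) L) (a₄ a₆ : L), B.det ≠ 0 →
      aeval (cubicSubst B (weierstrass3 (cuspDeformation a₄ a₆))) I = 0) : I = 0 := by
  refine eq_zero_of_curves (L := L) I (weierstrass3 (cuspDeformation 0 0)) fun y => ?_
  let T : L → Polynomial L := fun v => Polynomial.X * Polynomial.C v
  let B : Matrix (Fin 3) (Fin 3) (Polynomial L) :=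
    !![1 - T (y .a / 3), -T (y .a₂ / 3), -T (y .a₃ / 3);
       T (y .m / 2), 1, T (y .c₂ / 2);
       T (y .b₁), T (y .b), 1 + T (y .b₃)]
  refine ⟨cubicSubst B (weierstrass3 (cuspDeformation (-T (y .c₁)) (-T (y .c)))), B.det,
    ?_, ?_, ?_, ?_⟩
  · intro hB
    have := congrArg (Polynomial.eval 0) hB
    simp [B, T, Matrix.det_fin_three] at this
  · intro s
    cases s <;> simp [cubicSubst, cubicEval, cubicPolar, cubicPolarization, weierstrass3,
      cuspDeformation, B, T]
  · intro s
    cases s <;> simp [cubicSubst, cubicEval, cubicPolar, cubicPolarization, weierstrass3,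
      cuspDeformation, B, T, Polynomial.derivative_pow] <;> field_simp
  · intro t ht
    have hm := map_cubicSubst (Polynomial.evalRingHom t) B
      (weierstrass3 (cuspDeformation (-T (y .c₁)) (-T (y .c))))
    have hdet : (B.map (Polynomial.evalRingHom t)).det ≠ 0 := by
      rwa [← RingHom.mapMatrix_apply, ← RingHom.map_det]
    rw [map_weierstrass3_cuspDeformation, Polynomial.coe_evalRingHom] at hm
    rw [hm]
    exact h _ _ _ hdet

theorem IsInvariant3.eq_zero_of_weierstrass (h2 : (2 : K) ≠ 0) (h3 : (3 : K) ≠ 0) {k : ℕ}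
    {I : MvPolynomial Coord3 K} (hI : IsInvariant3 k I)
    (h : ∀ W : WeierstrassCurve (AlgebraicClosure K), aeval (weierstrass3 W) I = 0) : I = 0 := by
  refine eq_zero_of_cuspOrbit3 (ofNat_ne_zero_of_algebra (AlgebraicClosure K) h2)
    (ofNat_ne_zero_of_algebra (AlgebraicClosure K) h3) I fun B a₄ a₆ hB => ?_
  have := hI 1 (Matrix.GeneralLinearGroup.mkOfDetNeZero B hB) _ _ 
    (transforms3_cubicSubst B (weierstrass3 (cuspDeformation a₄ a₆)))
  rwa [h, mul_zero] at this

theorem discriminant_degree_three (h2 : (2 : K) ≠ 0) (h3 : (3 : K) ≠ 0) :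
    (∃! D : MvPolynomial Coord3 K, IsDiscriminant3 D) ∧
      ∀ D : MvPolynomial Coord3 K, IsDiscriminant3 D →
        ∀ φ : Coord3 → K, eval φ D = (1 / 2 : K) ^ 12 * (jacobian3 φ).Δ := by
  have h2L := ofNat_ne_zero_of_algebra (AlgebraicClosure K) h2
  have h6 : (6 : K) ≠ 0 := by rw [show (6 : K) = 2 * 3 by norm_num]; simp [h2, h3]
  refine discriminant_eq_of_invariants h2 h3 IsInvariant3 weierstrass3 jacobian3 (1 / 2)
    (-scaledS X) (C (2⁻¹ ^ 3) * scaledT X)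
    (fun k I J => IsInvariant3.sub) (fun k I => IsInvariant3.eq_zero_of_weierstrass h2 h3)
    ?_ ?_ ?_ ?_ ?_ ?_
  · intro μ B φ φ' h
    have hB : B.val.det ≠ 0 := (Matrix.GeneralLinearGroup.det B).ne_zero
    simp only [map_neg, map_scaledS, aeval_X]
    rw [h.eq_smul_cubicSubst h2L, scaledS_smul, (scaled_cubicSubst h2L hB φ).1]
    ring
  · intro μ B φ φ' h
    have hB : B.val.det ≠ 0 := (Matrix.GeneralLinearGroup.det B).ne_zero
    simp only [map_mul, map_scaledT, aeval_X, aeval_C]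
    rw [h.eq_smul_cubicSubst h2L, scaledT_smul, (scaled_cubicSubst h2L hB φ).2]
    ring
  · intro W
    simp only [map_neg, map_scaledS, aeval_X]
    simp [scaledS, ternaryS, weierstrass3, WeierstrassCurve.c₄, WeierstrassCurve.b₂,
      WeierstrassCurve.b₄]
    ring
  · intro W
    simp only [map_mul, map_scaledT, aeval_X, aeval_C, map_inv₀, map_pow,
      map_ofNat (algebraMap K (AlgebraicClosure K))]
    simp [scaledT, ternaryT, weierstrass3, WeierstrassCurve.c₆, WeierstrassCurve.b₂,
      WeierstrassCurve.b₄, WeierstrassCurve.b₆]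
    field_simp
    ring
  · intro φ
    simp only [map_neg, map_scaledS, eval_X]
    simp [scaledS, ternaryS, jacobian3, ClassicalForm.c₄, cubicS, aronholdS]
    field_simp
    ring
  · intro φ
    simp only [map_mul, map_scaledT, eval_X, eval_C]
    simp [scaledT, ternaryT, jacobian3, ClassicalForm.c₆, cubicT, aronholdT]
    field_simp
    ring

end Degree3

/-! ### Pencils of symmetric matrices -/

section Pencil

variable {R S : Type*} [CommRing R] [CommRing S]

/-- The polynomial `det (t M + N)` in `t`. -/
def pencilDet (M N : Matrix (Fin 4) (Fin 4) R) : Polynomial R :=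
  Matrix.det ((Polynomial.X : Polynomial R) • M.map (Polynomial.C : R →+* Polynomial R)
    + N.map (Polynomial.C : R →+* Polynomial R))

/-- The coefficients of the binary quartic `det (x M + z N)`. -/
def pencilForm (M N : Matrix (Fin 4) (Fin 4) R) : Fin 5 → R :=
  ![(pencilDet M N).coeff 4, (pencilDet M N).coeff 3, (pencilDet M N).coeff 2,
    (pencilDet M N).coeff 1, (pencilDet M N).coeff 0]

theorem map_pencilDet (g : R →+* S) (M N : Matrix (Fin 4) (Fin 4) R) :
    (pencilDet M N).map g = pencilDet (M.map g) (N.map g) := by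
  rw [pencilDet, pencilDet, ← Polynomial.coe_mapRingHom, RingHom.map_det]
  congr 1
  ext1 i j
  simp

theorem map_pencilForm (g : R →+* S) (M N : Matrix (Fin 4) (Fin 4) R) (i : Fin 5) :
    g (pencilForm M N i) = pencilForm (M.map g) (N.map g) i := by
  fin_cases i <;> simp [pencilForm, ← map_pencilDet]

theorem pencilDet_smul (c : R) (M N : Matrix (Fin 4) (Fin 4) R) :
    pencilDet (c • M) (c • N) = Polynomial.C (c ^ 4) * pencilDet M N := by
  have h : (Polynomial.X : Polynomial R) • (c • M).map (Polynomial.C : R →+* Polynomial R) +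
        (c • N).map (Polynomial.C : R →+* Polynomial R) =
      Polynomial.C c • ((Polynomial.X : Polynomial R) •
        M.map (Polynomial.C : R →+* Polynomial R) +
          N.map (Polynomial.C : R →+* Polynomial R)) := by
    ext1 i j
    simp
    ring
  rw [pencilDet, h, Matrix.det_smul, Fintype.card_fin, Polynomial.C_pow, pencilDet]

theorem pencilForm_smul (c : R) (M N : Matrix (Fin 4) (Fin 4) R) :
    pencilForm (c • M) (c • N) = c ^ 4 • pencilForm M N := by
  ext i
  fin_cases i <;> simp [pencilForm, pencilDet_smul, Polynomial.coeff_C_mul, -map_pow]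

theorem eval_pencilDet (M N : Matrix (Fin 4) (Fin 4) R) (t : R) :
    (pencilDet M N).eval t = (t • M + N).det := by
  rw [pencilDet, ← Polynomial.coe_evalRingHom, RingHom.map_det]
  congr 1
  ext1 i j
  simp
  ring

/-- The coefficients in `pencilForm` are those of the homogeneous form, also at the point `z = 0` at
infinity. -/
theorem binaryEval_pencilForm {L : Type*} [Field L] (M N : Matrix (Fin 4) (Fin 4) L) (x z : L) :
    binaryEval (pencilForm M N) x z = (x • M + z • N).det := by
  have h1 : ∀ t : L, binaryEval (pencilForm M N) t 1 = (t • M + N).det := by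
    intro t
    rw [← eval_pencilDet, Polynomial.eval_eq_sum_range' (n := 5)
      (Nat.lt_succ_of_le (by simpa [pencilDet] using Polynomial.natDegree_det_X_add_C_le M N))]
    simp [binaryEval, pencilForm, Finset.sum_range_succ]
    ring
  by_cases hz : z = 0
  · subst hz
    have := Polynomial.coeff_det_X_add_C_card M N
    simp only [Fintype.card_fin] at this
    simp [binaryEval, pencilForm, pencilDet, this]
    ring
  · have hM : x • M + z • N = z • ((x / z) • M + N) := by
      rw [smul_add, smul_smul, mul_div_cancel₀ _ hz]
    rw [hM, Matrix.det_smul, ← h1, Fintype.card_fin]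
    simp only [binaryEval]
    field_simp

end Pencil

/-! ### Quadrics in four variables -/

section Quadrics

variable {R S : Type*} [CommRing R] [CommRing S]

/-- The value of a quadric at `u`. -/
def quadricEval (q : QuadricCoord → R) (u : Fin 4 → R) : R :=
  q .c00 * u 0 ^ 2 + q .c01 * u 0 * u 1 + q .c02 * u 0 * u 2 + q .c03 * u 0 * u 3
    + q .c11 * u 1 ^ 2 + q .c12 * u 1 * u 2 + q .c13 * u 1 * u 3 + q .c22 * u 2 ^ 2
    + q .c23 * u 2 * u 3 + q .c33 * u 3 ^ 2

/-- The symmetric bilinear form `q(u + v) - q(u) - q(v)` of a quadric. -/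
def quadricPolar (q : QuadricCoord → R) (u v : Fin 4 → R) : R :=
  q .c00 * (2 * u 0 * v 0) + q .c01 * (u 0 * v 1 + u 1 * v 0) + q .c02 * (u 0 * v 2 + u 2 * v 0)
    + q .c03 * (u 0 * v 3 + u 3 * v 0) + q .c11 * (2 * u 1 * v 1)
    + q .c12 * (u 1 * v 2 + u 2 * v 1) + q .c13 * (u 1 * v 3 + u 3 * v 1)
    + q .c22 * (2 * u 2 * v 2) + q .c23 * (u 2 * v 3 + u 3 * v 2) + q .c33 * (2 * u 3 * v 3)

/-- The coefficients of the quadric `q ∘ B`. -/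
def quadricSubst (B : Matrix (Fin 4) (Fin 4) R) (q : QuadricCoord → R) : QuadricCoord → R
  | .c00 => quadricEval q (B.col 0)
  | .c01 => quadricPolar q (B.col 0) (B.col 1)
  | .c02 => quadricPolar q (B.col 0) (B.col 2)
  | .c03 => quadricPolar q (B.col 0) (B.col 3)
  | .c11 => quadricEval q (B.col 1)
  | .c12 => quadricPolar q (B.col 1) (B.col 2)
  | .c13 => quadricPolar q (B.col 1) (B.col 3)
  | .c22 => quadricEval q (B.col 2)
  | .c23 => quadricPolar q (B.col 2) (B.col 3)
  | .c33 => quadricEval q (B.col 3)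

/-- The Gram matrix of the polar form of a quadric, twice the matrix `A` with `q = x A xᵀ`. -/
def gramMatrix (q : QuadricCoord → R) : Matrix (Fin 4) (Fin 4) R :=
  !![2 * q .c00, q .c01, q .c02, q .c03;
     q .c01, 2 * q .c11, q .c12, q .c13;
     q .c02, q .c12, 2 * q .c22, q .c23;
     q .c03, q .c13, q .c23, 2 * q .c33]

theorem gramMatrix_smul (c : R) (q : QuadricCoord → R) :
    gramMatrix (c • q) = c • gramMatrix q := by
  ext i j
  fin_cases i <;> fin_cases j <;> simp [gramMatrix] <;> ring

theorem gramMatrix_add (q q' : QuadricCoord → R) :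
    gramMatrix (q + q') = gramMatrix q + gramMatrix q' := by
  ext i j
  fin_cases i <;> fin_cases j <;> simp [gramMatrix] <;> ring

theorem quadricPolar_eq_sum (q : QuadricCoord → R) (u v : Fin 4 → R) :
    quadricPolar q u v = ∑ j, (∑ i, u i * gramMatrix q i j) * v j := by
  simp [quadricPolar, gramMatrix, Fin.sum_univ_four]
  ring

theorem quadricPolar_comm (q : QuadricCoord → R) (u v : Fin 4 → R) :
    quadricPolar q u v = quadricPolar q v u := by
  simp only [quadricPolar]
  ring

theorem quadricPolar_self (q : QuadricCoord → R) (u : Fin 4 → R) :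
    quadricPolar q u u = 2 * quadricEval q u := by
  simp only [quadricPolar, quadricEval]
  ring

theorem gramMatrix_quadricSubst (B : Matrix (Fin 4) (Fin 4) R) (q : QuadricCoord → R) :
    gramMatrix (quadricSubst B q) = B.transpose * gramMatrix q * B := by
  have h : ∀ i j, gramMatrix (quadricSubst B q) i j = quadricPolar q (B.col i) (B.col j) := by
    intro i j
    fin_cases i <;> fin_cases j <;>
      first
      | exact (quadricPolar_self q _).symm
      | exact rfl
      | exact quadricPolar_comm q _ _
  ext i j
  rw [h, quadricPolar_eq_sum]
  simp [Matrix.mul_apply]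

theorem quadricForm_quadricSubst (B : Matrix (Fin 4) (Fin 4) R) (q : QuadricCoord → R) :
    quadricForm (quadricSubst B q) = linSubst B (quadricForm q) := by
  simp only [quadricForm, quadricSubst, quadricEval, quadricPolar, linSubst,
    Fin.sum_univ_four, Matrix.col_apply, map_add, map_mul, map_pow, aeval_X, algHom_C,
    MvPolynomial.algebraMap_eq, map_ofNat (C : R →+* MvPolynomial (Fin 4) R)]
  ring

theorem quadricForm_smul (c : R) (q : QuadricCoord → R) :
    quadricForm (c • q) = C c * quadricForm q := by
  simp only [quadricForm, Pi.smul_apply, smul_eq_mul, map_mul]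
  ring

theorem quadricForm_add (q q' : QuadricCoord → R) :
    quadricForm (q + q') = quadricForm q + quadricForm q' := by
  simp only [quadricForm, Pi.add_apply, map_add]
  ring

theorem quadricForm_injective : Function.Injective (quadricForm (R := R)) := by
  intro q q' h
  have key : ∀ v : Fin 4 → R, quadricEval q v = quadricEval q' v := fun v => by
    have := congrArg (eval v) h
    simp [quadricForm] at this
    simp only [quadricEval]
    linear_combination this
  have e00 := key ![1, 0, 0, 0]
  have e01 := key ![1, 1, 0, 0]
  have e02 := key ![1, 0, 1, 0]
  have e03 := key ![1, 0, 0, 1]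
  have e11 := key ![0, 1, 0, 0]
  have e12 := key ![0, 1, 1, 0]
  have e13 := key ![0, 1, 0, 1]
  have e22 := key ![0, 0, 1, 0]
  have e23 := key ![0, 0, 1, 1]
  have e33 := key ![0, 0, 0, 1]
  simp [quadricEval] at e00 e01 e02 e03 e11 e12 e13 e22 e23 e33
  ext s
  cases s
  · linear_combination e00
  · linear_combination e01 - e00 - e11
  · linear_combination e02 - e00 - e22
  · linear_combination e03 - e00 - e33
  · linear_combination e11
  · linear_combination e12 - e11 - e22
  · linear_combination e13 - e11 - e33
  · linear_combination e22
  · linear_combination e23 - e22 - e33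
  · linear_combination e33

end Quadrics

/-! ### Models of degree 4 -/

section Degree4

variable {R S : Type*} [CommRing R] [CommRing S]

/-- The transform `[A, B] φ` of a model of degree 4. -/
def model4Subst (A : Matrix (Fin 2) (Fin 2) R) (B : Matrix (Fin 4) (Fin 4) R) (φ : Coord4 → R) :
    Coord4 → R :=
  fun s => ∑ l, A s.1 l * quadricSubst B (fun s => φ (l, s)) s.2

theorem transforms4_model4Subst (A : Matrix (Fin 2) (Fin 2) R) (B : Matrix (Fin 4) (Fin 4) R)
    (φ : Coord4 → R) : Transforms4 A B φ (model4Subst A B φ) := by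
  intro k
  have h : (fun s => model4Subst A B φ (k, s)) =
      A k 0 • quadricSubst B (fun s => φ (0, s)) + A k 1 • quadricSubst B (fun s => φ (1, s)) := by
    ext s
    simp [model4Subst, Fin.sum_univ_two]
  rw [h, quadricForm_add, quadricForm_smul, quadricForm_smul, quadricForm_quadricSubst,
    quadricForm_quadricSubst, Fin.sum_univ_two]

theorem Transforms4.eq_model4Subst {A : Matrix (Fin 2) (Fin 2) R} {B : Matrix (Fin 4) (Fin 4) R}
    {φ φ' : Coord4 → R} (h : Transforms4 A B φ φ') : φ' = model4Subst A B φ := by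
  ext ⟨k, s⟩
  exact congrFun (quadricForm_injective ((h k).trans (transforms4_model4Subst A B φ k).symm)) s

/-- The binary quartic `det (2xA + 2zB) = 16 det (xA + zB)` of a model of degree 4. -/
def resolventQuartic (φ : Coord4 → R) : Fin 5 → R :=
  pencilForm (gramMatrix fun s => φ (0, s)) (gramMatrix fun s => φ (1, s))

theorem map_resolventQuartic (g : R →+* S) (φ : Coord4 → R) (i : Fin 5) :
    g (resolventQuartic φ i) = resolventQuartic (fun s => g (φ s)) i := by
  have h : ∀ q : QuadricCoord → R, (gramMatrix q).map g = gramMatrix fun s => g (q s) := by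
    intro q
    ext i j
    fin_cases i <;> fin_cases j <;> simp [gramMatrix, map_ofNat g]
  rw [resolventQuartic, map_pencilForm, h, h]
  rfl

/-- The second factor of the group scales `det (xA + zB)`, the first acts on it as on a binary
quartic. -/
theorem resolventQuartic_model4Subst {L : Type*} [Field L] [Infinite L]
    (A : Matrix (Fin 2) (Fin 2) L) (B : Matrix (Fin 4) (Fin 4) L) (φ : Coord4 → L) :
    resolventQuartic (model4Subst A B φ) =
      B.det ^ 2 • binarySubst A.transpose (resolventQuartic φ) := by
  have hg : ∀ k, gramMatrix (fun s => model4Subst A B φ (k, s)) =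
      B.transpose * (A k 0 • gramMatrix (fun s => φ (0, s)) +
        A k 1 • gramMatrix (fun s => φ (1, s))) * B := by
    intro k
    have h : (fun s => model4Subst A B φ (k, s)) =
        A k 0 • quadricSubst B (fun s => φ (0, s)) +
          A k 1 • quadricSubst B (fun s => φ (1, s)) := by
      ext s
      simp [model4Subst, Fin.sum_univ_two]
    rw [h, gramMatrix_add, gramMatrix_smul, gramMatrix_smul, gramMatrix_quadricSubst,
      gramMatrix_quadricSubst]
    simp only [Matrix.mul_add, Matrix.add_mul, Matrix.mul_smul, Matrix.smul_mul]
  refine binaryEval_injective fun x => ?_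
  rw [binaryEval_smul, binaryEval_binarySubst, resolventQuartic, resolventQuartic, binaryEval_pencilForm,
    binaryEval_pencilForm, hg, hg]
  set M := gramMatrix fun s => φ (0, s)
  set N := gramMatrix fun s => φ (1, s)
  have hM : x • (B.transpose * (A 0 0 • M + A 0 1 • N) * B) +
        (1 : L) • (B.transpose * (A 1 0 • M + A 1 1 • N) * B) =
      B.transpose * ((A.transpose 0 0 * x + A.transpose 0 1 * 1) • M +
        (A.transpose 1 0 * x + A.transpose 1 1 * 1) • N) * B := by
    rw [← Matrix.smul_mul, ← Matrix.mul_smul, ← Matrix.smul_mul, ← Matrix.mul_smul,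
      ← Matrix.add_mul, ← Matrix.mul_add]
    congr 2
    simp only [Matrix.transpose_apply]
    module
  rw [hM, Matrix.det_mul, Matrix.det_mul, Matrix.det_transpose]
  ring

/-- The resolvent quartic of a Weierstrass curve is its 2-division polynomial
`4x³ + b₂x² + 2b₄x + b₆`, homogenized to degree 4. -/
theorem resolventQuartic_weierstrass4 {L : Type*} [Field L] [Infinite L]
    (W : WeierstrassCurve L) :
    resolventQuartic (weierstrass4 W) = ![0, 4, W.b₂, 2 * W.b₄, W.b₆] := by
  refine binaryEval_injective fun x => ?_
  rw [resolventQuartic, binaryEval_pencilForm]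
  simp [gramMatrix, weierstrass4, Matrix.det_succ_row_zero, Fin.sum_univ_succ, Fin.succAbove,
    binaryEval, WeierstrassCurve.b₂, WeierstrassCurve.b₄, WeierstrassCurve.b₆]
  ring

theorem resolventQuartic_eq_pencilQuartic {K : Type*} [Field K] (h2 : (2 : K) ≠ 0)
    (φ : Coord4 → K) :
    resolventQuartic φ = (2 : K) ^ 4 • ![(pencilQuartic φ).coeff 4, (pencilQuartic φ).coeff 3,
      (pencilQuartic φ).coeff 2, (pencilQuartic φ).coeff 1, (pencilQuartic φ).coeff 0] := by
  have h : ∀ q : QuadricCoord → K, gramMatrix q = (2 : K) • symMatrix q := by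
    intro q
    ext i j
    fin_cases i <;> fin_cases j <;> simp [gramMatrix, symMatrix] <;> field_simp
  rw [resolventQuartic, h, h, pencilForm_smul]
  rfl

variable {K : Type*} [Field K]

theorem IsInvariant4.sub {k : ℕ} {I J : MvPolynomial Coord4 K} (hI : IsInvariant4 k I)
    (hJ : IsInvariant4 k J) : IsInvariant4 k (I - J) := by
  intro A B φ φ' h
  rw [map_sub, map_sub, hI A B φ φ' h, hJ A B φ φ' h, mul_sub]

theorem map_model4Subst (g : R →+* S) (A : Matrix (Fin 2) (Fin 2) R)
    (B : Matrix (Fin 4) (Fin 4) R) (φ : Coord4 → R) :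
    (fun s => g (model4Subst A B φ s)) =
      model4Subst (A.map g) (B.map g) fun s => g (φ s) := by
  ext ⟨k, s⟩
  cases s <;> simp [model4Subst, quadricSubst, quadricEval, quadricPolar, map_ofNat g]

theorem map_weierstrass4_cuspDeformation (g : R →+* S) (a₄ a₆ : R) :
    (fun s => g (weierstrass4 (cuspDeformation a₄ a₆) s)) =
      weierstrass4 (cuspDeformation (g a₄) (g a₆)) := by
  ext ⟨k, s⟩
  fin_cases k <;> cases s <;> simp [weierstrass4, cuspDeformation]

theorem model4Subst_one_one (φ : Coord4 → R) : model4Subst 1 1 φ = φ := by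
  have h : ∀ q : QuadricCoord → R, quadricSubst 1 q = q := fun q =>
    quadricForm_injective <| by
      rw [quadricForm_quadricSubst]
      have : linSubst (1 : Matrix (Fin 4) (Fin 4) R) = AlgHom.id R _ := by
        ext1 i
        simp [linSubst, Matrix.one_apply, apply_ite (C : R → MvPolynomial (Fin 4) R), ite_mul]
      rw [this, AlgHom.id_apply]
  ext ⟨k, s⟩
  simp [model4Subst, h, Matrix.one_apply]

theorem eval_quadricEval (q : QuadricCoord → Polynomial R) (u : Fin 4 → Polynomial R) (t : R) :
    (quadricEval q u).eval t = quadricEval (fun s => (q s).eval t) fun i => (u i).eval t := by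
  simp only [quadricEval, Polynomial.eval_add, Polynomial.eval_mul, Polynomial.eval_pow]

theorem eval_quadricPolar (q : QuadricCoord → Polynomial R) (u v : Fin 4 → Polynomial R) (t : R) :
    (quadricPolar q u v).eval t =
      quadricPolar (fun s => (q s).eval t) (fun i => (u i).eval t) fun i => (v i).eval t := by
  simp only [quadricPolar, Polynomial.eval_add, Polynomial.eval_mul, Polynomial.eval_ofNat]

theorem eval_derivative_quadricEval (q : QuadricCoord → Polynomial R) (u : Fin 4 → Polynomial R)
    (t : R) :
    (Polynomial.derivative (quadricEval q u)).eval t =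
      quadricEval (fun s => (Polynomial.derivative (q s)).eval t) (fun i => (u i).eval t) +
      quadricPolar (fun s => (q s).eval t) (fun i => (u i).eval t)
        (fun i => (Polynomial.derivative (u i)).eval t) := by
  simp only [quadricEval, quadricPolar, pow_two, Polynomial.derivative_add,
    Polynomial.derivative_mul, Polynomial.eval_add, Polynomial.eval_mul]
  ring

theorem eval_derivative_quadricPolar (q : QuadricCoord → Polynomial R)
    (u v : Fin 4 → Polynomial R) (t : R) :
    (Polynomial.derivative (quadricPolar q u v)).eval t =
      quadricPolar (fun s => (Polynomial.derivative (q s)).eval t) (fun i => (u i).eval t)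
        (fun i => (v i).eval t) +
      quadricPolar (fun s => (q s).eval t) (fun i => (Polynomial.derivative (u i)).eval t)
        (fun i => (v i).eval t) +
      quadricPolar (fun s => (q s).eval t) (fun i => (u i).eval t)
        (fun i => (Polynomial.derivative (v i)).eval t) := by
  simp only [quadricPolar, Polynomial.derivative_add, Polynomial.derivative_mul,
    Polynomial.derivative_ofNat, Polynomial.eval_add, Polynomial.eval_mul, Polynomial.eval_zero,
    Polynomial.eval_ofNat]
  ring

set_option maxHeartbeats 1000000 in
/-- The orbits of the curves `y² = x³ + a₄x + a₆` are dense in `X_4`: their tangent directions at the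
cuspidal model `(x₀x₃ - x₁², x₂² - x₁x₃)` span the space. With `A = 1 + t [0, α; β, 0]`,
`B = 1 + t Ξ`, `a₄ = t w₄` and `a₆ = t w₆`, the two velocities are
`x₃ξ₀ - 2x₁ξ₁ + x₀ξ₃ + α q₂` and `-x₃ξ₁ + 2x₂ξ₂ - x₁ξ₃ + β q₁ - w₄x₀x₁ - w₆x₀²`, where
`ξᵢ = ∑ j, Ξᵢⱼ xⱼ`. -/
theorem eq_zero_of_cuspOrbit4 {L : Type*} [Field L] [Infinite L] [Algebra K L]
    (h2 : (2 : L) ≠ 0) (h3 : (3 : L) ≠ 0) (I : MvPolynomial Coord4 K)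
    (h : ∀ (A : Matrix (Fin 2) (Fin 2) L) (B : Matrix (Fin 4) (Fin 4) L) (a₄ a₆ : L),
      A.det ≠ 0 → B.det ≠ 0 →
        aeval (model4Subst A B (weierstrass4 (cuspDeformation a₄ a₆))) I = 0) : I = 0 := by
  refine eq_zero_of_curves (L := L) I (weierstrass4 (cuspDeformation 0 0)) fun y => ?_
  let T : L → Polynomial L := fun v => Polynomial.X * Polynomial.C v
  -- The entries of `A`, `B`, `a₄`, `a₆` solve the linear system obtained by comparing these
  -- velocities with `y`. It is triangular with pivots `±1`, `±2` except for the three equations in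
  -- `Ξ₁₀`, `Ξ₃₁`, `β`, whose determinant is `-3`.
  let x₁₀ : L := -(y (0, .c01) + y (1, .c03) + y (1, .c11)) / 3
  let x₁₁ : L := -y (0, .c11) / 2
  let x₁₂ : L := -y (0, .c12) / 2
  let x₃₃ : L := -y (1, .c13) - x₁₁
  let A : Matrix (Fin 2) (Fin 2) (Polynomial L) :=
    !![1, T (y (0, .c22)); T (y (1, .c03) + x₁₀), 1]
  let B : Matrix (Fin 4) (Fin 4) (Polynomial L) :=
    !![1 + T (y (0, .c03) - x₃₃), T (y (0, .c13) - 2 * y (1, .c33) + y (0, .c22)),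
         T (y (0, .c23)), T (y (0, .c33));
       T x₁₀, 1 + T x₁₁, T x₁₂, T (-y (1, .c33));
       T (y (1, .c02) / 2), T ((y (1, .c12) + y (0, .c02)) / 2), 1 + T (y (1, .c22) / 2),
         T ((y (1, .c23) + x₁₂) / 2);
       T (y (0, .c00)), T (y (0, .c01) + 2 * x₁₀), T (y (0, .c02)), 1 + T x₃₃]
  let a₄ : Polynomial L := T (-y (0, .c00) - y (1, .c01))
  let a₆ : Polynomial L := T (-y (1, .c00))
  have hA : A.map (Polynomial.evalRingHom 0) = 1 := by
    ext i j
    fin_cases i <;> fin_cases j <;> simp [A, T]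
  have hB : B.map (Polynomial.evalRingHom 0) = 1 := by
    ext i j
    fin_cases i <;> fin_cases j <;> simp [B, T]
  refine ⟨model4Subst A B (weierstrass4 (cuspDeformation a₄ a₆)), A.det * B.det, ?_, ?_, ?_, ?_⟩
  · intro h0
    have := congrArg (Polynomial.evalRingHom 0) h0
    rw [map_mul, RingHom.map_det, RingHom.map_det, RingHom.mapMatrix_apply,
      RingHom.mapMatrix_apply, hA, hB] at this
    simp at this
  · intro s
    have hm := map_model4Subst (Polynomial.evalRingHom 0) A B
      (weierstrass4 (cuspDeformation a₄ a₆))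
    rw [hA, hB, model4Subst_one_one, map_weierstrass4_cuspDeformation] at hm
    simpa [a₄, a₆, T] using congrFun hm s
  · rintro ⟨k, s⟩
    fin_cases k <;> cases s <;>
      simp only [model4Subst, quadricSubst, Fin.sum_univ_two, Polynomial.derivative_add,
        Polynomial.derivative_mul, Polynomial.eval_add, Polynomial.eval_mul, eval_quadricEval,
        eval_quadricPolar, eval_derivative_quadricEval, eval_derivative_quadricPolar] <;>
      simp [quadricEval, quadricPolar, weierstrass4, cuspDeformation, A, B, T, a₄, a₆, x₁₀, x₁₁,
        x₁₂, x₃₃] <;> field_simp <;> ring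
  · intro t ht
    rw [Polynomial.eval_mul] at ht
    have hm := map_model4Subst (Polynomial.evalRingHom t) A B
      (weierstrass4 (cuspDeformation a₄ a₆))
    have hdetA : (A.map (Polynomial.evalRingHom t)).det ≠ 0 := by
      rw [← RingHom.mapMatrix_apply, ← RingHom.map_det]
      exact left_ne_zero_of_mul ht
    have hdetB : (B.map (Polynomial.evalRingHom t)).det ≠ 0 := by
      rw [← RingHom.mapMatrix_apply, ← RingHom.map_det]
      exact right_ne_zero_of_mul ht
    rw [map_weierstrass4_cuspDeformation, Polynomial.coe_evalRingHom] at hm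
    rw [hm]
    exact h _ _ _ _ hdetA hdetB

theorem IsInvariant4.eq_zero_of_weierstrass (h2 : (2 : K) ≠ 0) (h3 : (3 : K) ≠ 0) {k : ℕ}
    {I : MvPolynomial Coord4 K} (hI : IsInvariant4 k I)
    (h : ∀ W : WeierstrassCurve (AlgebraicClosure K), aeval (weierstrass4 W) I = 0) : I = 0 := by
  refine eq_zero_of_cuspOrbit4 (ofNat_ne_zero_of_algebra (AlgebraicClosure K) h2)
    (ofNat_ne_zero_of_algebra (AlgebraicClosure K) h3) I fun A B a₄ a₆ hA hB => ?_
  have := hI (Matrix.GeneralLinearGroup.mkOfDetNeZero A hA)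
    (Matrix.GeneralLinearGroup.mkOfDetNeZero B hB) _ _
    (transforms4_model4Subst A B (weierstrass4 (cuspDeformation a₄ a₆)))
  rwa [h, mul_zero] at this

theorem discriminant_degree_four (h2 : (2 : K) ≠ 0) (h3 : (3 : K) ≠ 0) :
    (∃! D : MvPolynomial Coord4 K, IsDiscriminant4 D) ∧
      ∀ D : MvPolynomial Coord4 K, IsDiscriminant4 D →
        ∀ φ : Coord4 → K, eval φ D = (2 : K) ^ 12 * (jacobian4 φ).Δ := by
  have h2L := ofNat_ne_zero_of_algebra (AlgebraicClosure K) h2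
  have h12 : (12 : K) ≠ 0 := by rw [show (12 : K) = 2 ^ 2 * 3 by norm_num]; simp [h2, h3]
  have h432 : (432 : K) ≠ 0 := by
    rw [show (432 : K) = 2 ^ 4 * 3 ^ 3 by norm_num]; simp [h2, h3]
  have haeval : ∀ (φ : Coord4 → AlgebraicClosure K) (i : Fin 5),
      aeval φ (resolventQuartic (X : Coord4 → MvPolynomial Coord4 K) i) =
        resolventQuartic φ i := fun φ i => by
    simpa using map_resolventQuartic (aeval φ : MvPolynomial Coord4 K →ₐ[K] _).toRingHom X i
  have heval : ∀ (φ : Coord4 → K) (i : Fin 5),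
      eval φ (resolventQuartic (X : Coord4 → MvPolynomial Coord4 K) i) =
        resolventQuartic φ i := fun φ i => by
    simpa using map_resolventQuartic (eval φ) X i
  refine discriminant_eq_of_invariants h2 h3 IsInvariant4 weierstrass4 jacobian4 2
    (binaryI (resolventQuartic X)) (C 2⁻¹ * binaryJ (resolventQuartic X))
    (fun k I J => IsInvariant4.sub) (fun k I => IsInvariant4.eq_zero_of_weierstrass h2 h3)
    ?_ ?_ ?_ ?_ ?_ ?_
  · intro A B φ φ' h
    simp only [map_binaryI, haeval]
    rw [h.eq_model4Subst, resolventQuartic_model4Subst, binaryI_smul, binaryI_binarySubst,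
      Matrix.det_transpose]
    ring
  · intro A B φ φ' h
    simp only [map_mul, map_binaryJ, haeval, aeval_C]
    rw [h.eq_model4Subst, resolventQuartic_model4Subst, binaryJ_smul, binaryJ_binarySubst,
      Matrix.det_transpose]
    ring
  · intro W
    simp only [map_binaryI, haeval]
    rw [resolventQuartic_weierstrass4]
    simp [binaryI, WeierstrassCurve.c₄]
    ring
  · intro W
    simp only [map_mul, map_binaryJ, haeval, aeval_C, map_inv₀,
      map_ofNat (algebraMap K (AlgebraicClosure K))]
    rw [resolventQuartic_weierstrass4]
    simp [binaryJ, WeierstrassCurve.c₆]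
    field_simp
    ring
  · intro φ
    simp only [map_binaryI, heval]
    rw [resolventQuartic_eq_pencilQuartic h2, binaryI_smul]
    simp [binaryI, jacobian4, ClassicalForm.c₄, quarticI]
    field_simp
    ring
  · intro φ
    simp only [map_mul, map_binaryJ, heval, eval_C]
    rw [resolventQuartic_eq_pencilQuartic h2, binaryJ_smul]
    simp [binaryJ, jacobian4, ClassicalForm.c₆, quarticJ]
    field_simp
    ring

end Degree4

end GenusOne

end

theorem theorem1p1 {K : Type*} [Field K] (h2 : (2 : K) ≠ 0) (h3 : (3 : K) ≠ 0) :
    ((∃! D : MvPolynomial GenusOne.Coord2 K, GenusOne.IsDiscriminant2 D) ∧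
      ∀ D : MvPolynomial GenusOne.Coord2 K, GenusOne.IsDiscriminant2 D →
        ∀ φ : GenusOne.Coord2 → K,
          MvPolynomial.eval φ D = (1 : K) ^ 12 * (GenusOne.jacobian2 φ).Δ) ∧
    ((∃! D : MvPolynomial GenusOne.Coord3 K, GenusOne.IsDiscriminant3 D) ∧
      ∀ D : MvPolynomial GenusOne.Coord3 K, GenusOne.IsDiscriminant3 D →
        ∀ φ : GenusOne.Coord3 → K,
          MvPolynomial.eval φ D = (1 / 2 : K) ^ 12 * (GenusOne.jacobian3 φ).Δ) ∧
    ((∃! D : MvPolynomial GenusOne.Coord4 K, GenusOne.IsDiscriminant4 D) ∧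
      ∀ D : MvPolynomial GenusOne.Coord4 K, GenusOne.IsDiscriminant4 D →
        ∀ φ : GenusOne.Coord4 → K,
          MvPolynomial.eval φ D = (2 : K) ^ 12 * (GenusOne.jacobian4 φ).Δ) :=
  ⟨GenusOne.discriminant_degree_two h2 h3, GenusOne.discriminant_degree_three h2 h3,
    GenusOne.discriminant_degree_four h2 h3⟩
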